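/- Let $k$ be a finite field and let $\mathcal A$ be a finitary hereditary $k$-linear abelian category: $\operatorname{Hom}_{\mathcal A}(X,Y)$ and $\operatorname{Ext}^1_{\mathcal A}(X,Y)$ are finite and $\operatorname{Ext}^n_{\mathcal A}(X,Y)=0$ for all $n\ge 2$ and all $X,Y\in\mathcal A$. Notation. $\operatorname{Iso}(\mathcal C)$ is the set of isomorphism classes of a category $\mathcal C$, and $a_X=|\operatorname{Aut}(X)|$. For $X,Y,L\in\mathcal A$, the Hall number $g^L_{XY}$ is the number of subobjects $L'$ of $L$ with $L'\cong Y$ and $L/L'\cong X$, and $\langle \widehat X,\widehat Y\rangle=|\operatorname{Hom}_{\mathcal A}(X,Y)|/|\operatorname{Ext}^1_{\mathcal A}(X,Y)|$. Let $\mathcal D_0(\mathcal A)=\mathcal D^b(\mathcal A)$ be the bounded derived category. For $X,Y,L\in\mathcal D_0(\mathcal A)$ let $\operatorname{Hom}(L,X)_{Y[1]}$ be the set of morphisms $L\to X$ whose cone is isomorphic to $Y[1]$, put $\{X,Y\}=\prod_{i>0}|\operatorname{Hom}(X[i],Y)|^{(-1)^i}$ and $$F_{XY}^L=\frac{|\operatorname{Hom}(L,X)_{Y[1]}|}{a_X}\cdot\frac{\{L,X\}}{\{X,X\}}.$$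 The derived Hall algebra $\mathcal{DH}_0(\mathcal A)$ is the $\mathbb Q$-vector space with basis $\operatorname{Iso}(\mathcal D_0(\mathcal A))$ and with the bilinear multiplication given by $[X][Y]=\sum_{[L]}F_{XY}^L[L]$. Proposition. Let $A_1^\bullet=(A_1^i,0)_{i\in\mathbb Z}$ and $A_2^\bullet=(A_2^i,0)_{i\in\mathbb Z}$ be bounded cochain complexes over $\mathcal A$ with zero differentials. Then in $\mathcal{DH}_0(\mathcal A)$ $$[A_1^\bullet][A_2^\bullet]=\sum_{X^\bullet=(X^i,0)_{i\in\mathbb Z}}\ \sum_{(I^i),(M^i),(N^i)}\left(\prod_{i\in\mathbb Z}g^{A_1^i}_{I^iM^i}\,g^{X^i}_{M^iN^i}\,g^{A_2^i}_{N^iI^{i-1}}\,\frac{a_{N^i}a_{M^i}a_{I^i}}{a_{A_1^i}a_{A_2^i}}\cdot\frac{\prod_{k\ge 2}\langle\widehat{A_2^{i+k}},\widehat{A_1^{i}}\rangle^{(-1)^k}}{\langle\widehat{N^{i+1}},\widehat{M^i}\rangle}\right)[X^\bullet],$$ where $(X^i)$, $(I^i)$, $(M^i)$, $(N^i)$ run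 over the families, indexed by $i\in\mathbb Z$, of elements of $\operatorname{Iso}(\mathcal A)$ of which all but finitely many are $0$, and $X^\bullet$ is the complex with components $X^i$ and zero differential. Moreover, only finitely many $[L]$ satisfy $F^L_{A_1^\bullet A_2^\bullet}\neq0$, and only finitely many quadruples $((X^i),(I^i),(M^i),(N^i))$ contribute a nonzero term to the sum on the right. -/

import Mathlib

open CategoryTheory CategoryTheory.Limits CategoryTheory.Pretriangulated
open scoped ZeroObject

universe w w' v u

noncomputable section

namespace DerivedHall

/-! ### Isomorphism classes and cardinalities of automorphism groups -/

/-- The set `Iso(C)` of isomorphism classes `[X]` of objects of a category `C`. -/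
def IsoClass (C : Type u) [Category.{v} C] : Type u :=
  Quotient (isIsomorphicSetoid C)

section

variable {C : Type u} [Category.{v} C]

/-- The isomorphism class of an object. -/
def IsoClass.mk (X : C) : IsoClass C := Quotient.mk (isIsomorphicSetoid C) X

/-- A chosen representative of an isomorphism class.  It is only used inside quantities that are
invariant under isomorphism. -/
def IsoClass.rep (x : IsoClass C) : C := Quotient.out x

instance [HasZeroMorphisms C] [HasZeroObject C] : Zero (IsoClass C) := ⟨IsoClass.mk (0 : C)⟩

/-- `a_X`, the cardinality of the automorphism group of `X`. -/
def autCard (X : C) : ℚ := (Nat.card (Aut X) : ℚ)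

end

/-! ### The derived Hall algebra of a triangulated category -/

section Triangulated

variable {T : Type u} [Category.{v} T] [HasZeroObject T] [Preadditive T] [HasShift T ℤ]
  [∀ n : ℤ, (shiftFunctor T n).Additive] [Pretriangulated T]

/-- `Hom(Y, L)_X`, the set of morphisms `Y ⟶ L` whose cone is isomorphic to `X`. -/
def homWithCone (Y L X : T) : Set (Y ⟶ L) :=
  {f | ∃ (g : L ⟶ X) (h : X ⟶ Y⟦(1 : ℤ)⟧), Triangle.mk f g h ∈ distTriang T}

/-- `{X, Y} = ∏_{i > 0} |Hom(X[i], Y)| ^ ((-1) ^ i)`. -/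
def curly (X Y : T) : ℚ :=
  ∏ᶠ (i : ℕ) (_ : 0 < i), (Nat.card (X⟦(i : ℤ)⟧ ⟶ Y) : ℚ) ^ ((-1 : ℤ) ^ i)

/-- The derived Hall number
`F_{XY}^L = |Hom(L, X)_{Y[1]}| / a_X * {L, X} / {X, X}`. -/
def derivedHallNumber (X Y L : T) : ℚ :=
  (Nat.card (homWithCone L X (Y⟦(1 : ℤ)⟧)) : ℚ) / autCard X * (curly L X / curly X X)

end Triangulated

/-- The vector space underlying the derived Hall algebra of `T`: the `ℚ`-vector space with basis
the isomorphism classes of objects of `T`. -/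
def DerivedHallAlgebra (T : Type u) [Category.{v} T] : Type u := IsoClass T →₀ ℚ

section Algebra

variable {T : Type u} [Category.{v} T]

instance : AddCommGroup (DerivedHallAlgebra T) := inferInstanceAs (AddCommGroup (IsoClass T →₀ ℚ))

instance : Module ℚ (DerivedHallAlgebra T) := inferInstanceAs (Module ℚ (IsoClass T →₀ ℚ))

/-- The basis element given by an isomorphism class. -/
def basisClass (x : IsoClass T) : DerivedHallAlgebra T := Finsupp.single x (1 : ℚ)

/-- The basis element `[X]` given by an object `X`. -/
def basisObj (X : T) : DerivedHallAlgebra T := basisClass (IsoClass.mk X)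

variable [HasZeroObject T] [Preadditive T] [HasShift T ℤ]
  [∀ n : ℤ, (shiftFunctor T n).Additive] [Pretriangulated T]

/-- The product `[X][Y] = ∑_{[L]} F_{XY}^L [L]` of two basis elements. -/
def basisMul (x y : IsoClass T) : DerivedHallAlgebra T :=
  ∑ᶠ l : IsoClass T, derivedHallNumber x.rep y.rep l.rep • basisClass l

/-- The multiplication of the derived Hall algebra, extended bilinearly from the basis. -/
instance : Mul (DerivedHallAlgebra T) where
  mul f g := Finsupp.sum (f : IsoClass T →₀ ℚ) fun x r =>
    Finsupp.sum (g : IsoClass T →₀ ℚ) fun y s => (r * s) • basisMul x y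

end Algebra

/-! ### Finitary hereditary abelian categories -/

section Abelian

variable (A : Type u) [Category.{v} A] [Abelian A]

/-- An abelian category is finitary and hereditary if its groups `Hom` and `Ext¹` are finite and
its groups `Extⁿ` vanish for `n ≥ 2`. -/
class IsFinitaryHereditary [HasExt.{w'} A] : Prop where
  finite_hom (X Y : A) : Finite (X ⟶ Y)
  finite_ext_one (X Y : A) : Finite (Abelian.Ext.{w'} X Y 1)
  subsingleton_ext (X Y : A) (n : ℕ) (hn : 2 ≤ n) : Subsingleton (Abelian.Ext.{w'} X Y n)

variable {A}

/-- The Hall number `g_{XY}^L`: the number of subobjects `L'` of `L` such that `L' ≅ Y` and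
`L / L' ≅ X`. -/
def hallNumber (X Y L : A) : ℚ :=
  (Nat.card {S : Subobject L // Nonempty ((S : A) ≅ Y) ∧ Nonempty (cokernel S.arrow ≅ X)} : ℚ)

/-- The multiplicative Euler form `⟨X, Y⟩ = |Hom(X, Y)| / |Ext¹(X, Y)|`. -/
def euler [HasExt.{w'} A] (X Y : A) : ℚ :=
  (Nat.card (X ⟶ Y) : ℚ) / (Nat.card (Abelian.Ext.{w'} X Y 1) : ℚ)

/-! ### Bounded complexes -/

/-- A complex is bounded if all but finitely many of its components are zero. -/
def IsBoundedComplex (K : CochainComplex A ℤ) : Prop :=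
  {i : ℤ | ¬ IsZero (K.X i)}.Finite

/-- A bounded complex, seen as an object of the bounded derived category. -/
def toBounded [HasDerivedCategory.{w} A] (K : CochainComplex A ℤ) (hK : IsBoundedComplex K) :
    DerivedCategory.Bounded A :=
  ⟨DerivedCategory.Q.obj K, by
    refine ⟨?_, ?_⟩
    · obtain ⟨n, hn⟩ := hK.bddBelow
      exact ⟨n, K, Iso.refl _, (K.isStrictlyGE_iff n).2 fun i hi =>
        by_contra fun h => (not_le.2 hi) (hn h)⟩
    · obtain ⟨n, hn⟩ := hK.bddAbove
      exact ⟨n, K, Iso.refl _, (K.isStrictlyLE_iff n).2 fun i hi =>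
        by_contra fun h => (not_le.2 hi) (hn h)⟩⟩

/-- The complex `(X^i, 0)` with zero differential given by a finitely supported family of
isomorphism classes of objects `X^i`.  (Finite support means: `X^i` is the class of the zero
object for all but finitely many `i`.) -/
def zeroDiffComplex (X : ℤ →₀ IsoClass A) : CochainComplex A ℤ where
  X i := (X i).rep
  d _ _ := 0

theorem zeroDiffComplex_isBounded (X : ℤ →₀ IsoClass A) :
    IsBoundedComplex (zeroDiffComplex X) := by
  refine X.support.finite_toSet.subset fun i hi => Finsupp.mem_support_iff.2 fun h0 => hi ?_
  have h : IsoClass.mk ((X i).rep) = IsoClass.mk (0 : A) := (Quotient.out_eq (X i)).trans h0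
  obtain ⟨e⟩ := Quotient.exact h
  exact (isZero_zero A).of_iso e

/-- The summand, for fixed zero-differential complexes `A₁`, `A₂` and families of isomorphism
classes `X`, `I`, `M`, `N`:
`∏_i g^{A₁^i}_{I^i M^i} g^{X^i}_{M^i N^i} g^{A₂^i}_{N^i I^{i-1}}
  (a_{N^i} a_{M^i} a_{I^i} / (a_{A₁^i} a_{A₂^i}))
  (∏_{k ≥ 2} ⟨A₂^{i+k}, A₁^i⟩ ^ ((-1) ^ k)) / ⟨N^{i+1}, M^i⟩`. -/
def structureTerm [HasExt.{w'} A] (A₁ A₂ : CochainComplex A ℤ)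
    (X I M N : ℤ →₀ IsoClass A) : ℚ :=
  ∏ᶠ i : ℤ,
    hallNumber (I i).rep (M i).rep (A₁.X i) *
    hallNumber (M i).rep (N i).rep (X i).rep *
    hallNumber (N i).rep (I (i - 1)).rep (A₂.X i) *
    (autCard (N i).rep * autCard (M i).rep * autCard (I i).rep /
      (autCard (A₁.X i) * autCard (A₂.X i))) *
    ((∏ᶠ (k : ℕ) (_ : 2 ≤ k), euler.{w'} (A₂.X (i + k)) (A₁.X i) ^ ((-1 : ℤ) ^ k)) /
      euler.{w'} (N (i + 1)).rep (M i).rep)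

end Abelian

end DerivedHall

end

/-!
The product `[A₁][A₂]` is computed by counting, for every `L` with zero differential, the morphisms
`f : L ⟶ A₁` in the derived category whose cone is `A₂⟦1⟧`.

Since `Extⁿ` vanishes for `n ≥ 2`, every bounded object is the direct sum of its cohomology objects
(`exists_formalDecomp`), so that the complexes with zero differential represent all isomorphism
classes (`isoClassEquiv`). A morphism between two such objects is an arbitrary pair of a family
`φⁱ : Lⁱ ⟶ A₁ⁱ` and a family `εⁱ ∈ Ext¹(Lⁱ⁺¹, A₁ⁱ)` (`FormalDecomp.homEquiv`).

The key point is the shape of the cone: its cohomology in degree `i` is the middle term of the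
extension of `ker φⁱ⁺¹` by `coker φⁱ` whose class is the image of `εⁱ` in
`Ext¹(ker φⁱ⁺¹, coker φⁱ)` (`FormalDecomp.nonempty_homology_cone_iso`). Hence `f` has cone `A₂⟦1⟧`
if and only if these extensions have middle terms `A₂ⁱ⁺¹`, for all `i`
(`FormalDecomp.mem_homWithCone_iff`).

Now sort the morphisms by the classes `Iⁱ`, `Mⁱ`, `Nⁱ` of the cokernels, images and kernels of the
`φⁱ`. The number of `φⁱ` of a given type is `a_M g^L_{MN} g^{A₁}_{IM}` (`card_homs`), Riedtmann's
formula counts the classes in `Ext¹(Nⁱ⁺¹, Iⁱ)` with middle term `A₂ⁱ⁺¹`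
(`card_homWithCone_single_eq`), and `Ext¹(Lⁱ⁺¹, A₁ⁱ)` maps onto `Ext¹(Nⁱ⁺¹, Iⁱ)`
(`card_ext_preimage`). This gives `FormalDecomp.natCard_fibre`.

It remains to compare the powers of cardinalities of `Hom` and `Ext¹`. If the Hall numbers do not
vanish, then the Euler form is additive on the three families of short exact sequences relating
`L`, `A₁`, `A₂` to `I`, `M`, `N`, and the alternating products over the shifts cancel except for the
factors of the formula (`altEuler_identity`).
-/

open DerivedCategory

noncomputable section

namespace DerivedHall

/-! ### Counting morphisms in an abelian category -/

section

/-- Isomorphisms between isomorphic objects form a torsor under the automorphism group. -/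
def isoEquivAut {C : Type u} [Category.{v} C] {X Y : C} (e : X ≅ Y) : (X ≅ Y) ≃ Aut X where
  toFun a := a ≪≫ e.symm
  invFun a := Iso.trans a e
  left_inv a := by ext; simp
  right_inv a := by
    ext
    change (a.hom ≫ e.hom) ≫ e.inv = a.hom
    simp

/-- A variant of `isoEquivAut` with the automorphism group of the target. -/
def isoEquivAut' {C : Type u} [Category.{v} C] {X Y : C} (e : X ≅ Y) : (X ≅ Y) ≃ Aut Y where
  toFun a := e.symm ≪≫ a
  invFun a := Iso.trans e a
  left_inv a := by ext; simp
  right_inv a := by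
    ext
    change e.inv ≫ e.hom ≫ a.hom = a.hom
    simp

theorem autCard_congr {C : Type u} [Category.{v} C] {X Y : C} (e : X ≅ Y) :
    autCard X = autCard Y := by
  unfold autCard
  rw [Nat.card_congr ((isoEquivAut e).symm.trans (isoEquivAut' e))]

theorem finite_aut {C : Type u} [Category.{v} C] (X : C) [Finite (X ⟶ X)] : Finite (Aut X) :=
  Finite.of_injective (fun a : Aut X => a.hom) fun _ _ h => Iso.ext h

theorem autCard_pos {C : Type u} [Category.{v} C] (X : C) [Finite (X ⟶ X)] : 0 < autCard X := by
  have := finite_aut X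
  unfold autCard
  exact_mod_cast Nat.card_pos

theorem natCard_sigma_const {α : Type*} {β : α → Type*} {γ : Type*} (e : ∀ a, β a ≃ γ) :
    Nat.card (Σ a, β a) = Nat.card α * Nat.card γ := by
  rw [Nat.card_congr ((Equiv.sigmaCongrRight e).trans (Equiv.sigmaEquivProd α γ)), Nat.card_prod]

section

variable {A : Type u} [Category.{v} A] [Abelian A]

/-- Monomorphisms `Y ⟶ L` with cokernel `X` are the subobjects of `L` counted by the Hall number
`g_{XY}^L`, each together with an identification with `Y`. -/
theorem card_monos (X Y L : A) :
    (Nat.card {m : Y ⟶ L // Mono m ∧ Nonempty (cokernel m ≅ X)} : ℚ) =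
      autCard Y * hallNumber X Y L := by
  let α := {S : Subobject L // Nonempty ((S : A) ≅ Y) ∧ Nonempty (cokernel S.arrow ≅ X)}
  let F : (Σ S : α, (Y ≅ (S.1 : A))) → {m : Y ⟶ L // Mono m ∧ Nonempty (cokernel m ≅ X)} :=
    fun q => ⟨q.2.hom ≫ q.1.1.arrow, mono_comp _ _, by
      obtain ⟨e⟩ := q.1.2.2
      exact ⟨cokernelEpiComp q.2.hom q.1.1.arrow ≪≫ e⟩⟩
  have hF : Function.Bijective F := by
    constructor
    · rintro ⟨⟨S, hS⟩, e⟩ ⟨⟨S', hS'⟩, e'⟩ h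
      have h1 : e.hom ≫ S.arrow = e'.hom ≫ S'.arrow := congrArg Subtype.val h
      have h2 : S = S' := by
        rw [← Subobject.mk_arrow S, ← Subobject.mk_arrow S']
        exact Subobject.mk_eq_mk_of_comm _ _ (e.symm ≪≫ e') (by simp [← h1])
      subst h2
      have h3 : e = e' := by
        ext1
        exact (cancel_mono _).1 h1
      subst h3
      rfl
    · rintro ⟨m, hm, ⟨e⟩⟩
      have hc : cokernel (Subobject.mk m).arrow ≅ X :=
        cokernelIsoOfEq (Subobject.underlyingIso_hom_comp_eq_mk m).symm ≪≫
          cokernelEpiComp _ _ ≪≫ e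
      exact ⟨⟨⟨Subobject.mk m, ⟨Subobject.underlyingIso m⟩, ⟨hc⟩⟩,
        (Subobject.underlyingIso m).symm⟩, Subtype.ext (by simp [F])⟩
  have h := natCard_sigma_const (α := α) (β := fun S => (Y ≅ (S.1 : A))) (γ := Aut Y)
    fun S => isoEquivAut S.2.1.some.symm
  rw [Nat.card_congr (Equiv.ofBijective F hF)] at h
  rw [h, autCard, hallNumber]
  push_cast
  ring

/-- Epimorphisms `L ⟶ X` with kernel `Y` are the subobjects of `L` counted by the Hall number
`g_{XY}^L`, each together with an identification of the quotient with `X`. -/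
theorem card_epis (X Y L : A) :
    (Nat.card {p : L ⟶ X // Epi p ∧ Nonempty (kernel p ≅ Y)} : ℚ) =
      autCard X * hallNumber X Y L := by
  let α := {S : Subobject L // Nonempty ((S : A) ≅ Y) ∧ Nonempty (cokernel S.arrow ≅ X)}
  let F : (Σ S : α, (cokernel S.1.arrow ≅ X)) → {p : L ⟶ X // Epi p ∧ Nonempty (kernel p ≅ Y)} :=
    fun q => ⟨cokernel.π q.1.1.arrow ≫ q.2.hom, epi_comp _ _, by
      obtain ⟨e⟩ := q.1.2.1
      refine ⟨kernelCompMono _ _ ≪≫ ?_ ≪≫ e⟩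
      exact (Abelian.imageIsoImage q.1.1.arrow) ≪≫ imageMonoIsoSource _⟩
  have key : ∀ (S S' : Subobject L) (e : cokernel S.arrow ≅ X) (e' : cokernel S'.arrow ≅ X),
      cokernel.π S.arrow ≫ e.hom = cokernel.π S'.arrow ≫ e'.hom → S ≤ S' := by
    intro S S' e e' h
    have h1 : S.arrow ≫ cokernel.π S'.arrow = 0 := by
      rw [← cancel_mono e'.hom, Category.assoc, ← h]
      simp
    exact Subobject.le_of_comm (Abelian.monoLift S'.arrow S.arrow h1)
      (Abelian.monoLift_comp S'.arrow S.arrow h1)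
  have hF : Function.Bijective F := by
    constructor
    · rintro ⟨⟨S, hS⟩, e⟩ ⟨⟨S', hS'⟩, e'⟩ h
      have h1 : cokernel.π S.arrow ≫ e.hom = cokernel.π S'.arrow ≫ e'.hom :=
        congrArg Subtype.val h
      have h2 : S = S' := le_antisymm (key _ _ _ _ h1) (key _ _ _ _ h1.symm)
      subst h2
      have h3 : e = e' := by
        ext1
        exact (cancel_epi _).1 h1
      subst h3
      rfl
    · rintro ⟨p, hp, ⟨e⟩⟩
      have hS : (ShortComplex.mk (kernelSubobject p).arrow p (by simp)).ShortExact :=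
        { exact := ShortComplex.exact_of_f_is_kernel _ (IsKernel.isoKernel p _
            (kernelIsKernel p) (kernelSubobjectIso p) (by simp))
          mono_f := inferInstance
          epi_g := hp }
      let c := (cokernelIsCokernel (kernelSubobject p).arrow).coconePointUniqueUpToIso
        hS.gIsCokernel
      have hc : cokernel.π (kernelSubobject p).arrow ≫ c.hom = p :=
        (cokernelIsCokernel _).comp_coconePointUniqueUpToIso_hom hS.gIsCokernel .one
      exact ⟨⟨⟨kernelSubobject p, ⟨kernelSubobjectIso p ≪≫ e⟩, ⟨c⟩⟩, c⟩, Subtype.ext hc⟩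
  have h := natCard_sigma_const (α := α) (β := fun S => (cokernel S.1.arrow ≅ X)) (γ := Aut X)
    fun S => isoEquivAut' S.2.2.some
  rw [Nat.card_congr (Equiv.ofBijective F hF)] at h
  rw [h, autCard, hallNumber]
  push_cast
  ring

/-- Every morphism factors uniquely, up to an automorphism of its image, as an epimorphism
followed by a monomorphism. -/
theorem card_homs (X Y N M I : A) [Finite (M ⟶ M)] :
    (Nat.card {φ : X ⟶ Y // Nonempty (kernel φ ≅ N) ∧ Nonempty (image φ ≅ M) ∧
      Nonempty (cokernel φ ≅ I)} : ℚ) =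
      autCard M * hallNumber M N X * hallNumber I M Y := by
  let α := {φ : X ⟶ Y // Nonempty (kernel φ ≅ N) ∧ Nonempty (image φ ≅ M) ∧
      Nonempty (cokernel φ ≅ I)}
  let F : (Σ φ : α, (image φ.1 ≅ M)) →
      {p : X ⟶ M // Epi p ∧ Nonempty (kernel p ≅ N)} ×
        {m : M ⟶ Y // Mono m ∧ Nonempty (cokernel m ≅ I)} :=
    fun q => ⟨⟨factorThruImage q.1.1 ≫ q.2.hom, epi_comp _ _, by
        obtain ⟨e⟩ := q.1.2.1
        exact ⟨kernelCompMono _ _ ≪≫ (kernelCompMono _ (image.ι q.1.1)).symm ≪≫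
          kernelIsoOfEq (image.fac _) ≪≫ e⟩⟩,
      ⟨q.2.inv ≫ image.ι q.1.1, mono_comp _ _, by
        obtain ⟨e⟩ := q.1.2.2.2
        exact ⟨cokernelEpiComp _ _ ≪≫ (cokernelEpiComp (factorThruImage q.1.1) _).symm ≪≫
          cokernelIsoOfEq (image.fac _) ≪≫ e⟩⟩⟩
  have hF : Function.Bijective F := by
    constructor
    · rintro ⟨⟨φ, hφ⟩, e⟩ ⟨⟨φ', hφ'⟩, e'⟩ h
      have h1 : factorThruImage φ ≫ e.hom = factorThruImage φ' ≫ e'.hom :=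
        congrArg (fun z => z.1.1) h
      have h2 : e.inv ≫ image.ι φ = e'.inv ≫ image.ι φ' := congrArg (fun z => z.2.1) h
      have h3 : φ = φ' := by
        calc φ = (factorThruImage φ ≫ e.hom) ≫ e.inv ≫ image.ι φ := by simp
          _ = φ' := by rw [h1, h2]; simp
      subst h3
      have h4 : e = e' := by
        ext1
        exact (cancel_epi _).1 h1
      subst h4
      rfl
    · rintro ⟨⟨p, hp, ⟨eN⟩⟩, ⟨m, hm, ⟨eI⟩⟩⟩
      have : StrongEpi p := strongEpi_of_epi p
      let e : M ≅ image (p ≫ m) := image.isoStrongEpiMono p m rfl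
      have h2 : e.hom ≫ image.ι (p ≫ m) = m := image.isoStrongEpiMono_hom_comp_ι p m rfl
      refine ⟨⟨⟨p ≫ m, ⟨kernelCompMono _ _ ≪≫ eN⟩, ⟨e.symm⟩, ⟨cokernelEpiComp _ _ ≪≫ eI⟩⟩,
        e.symm⟩, Prod.ext (Subtype.ext ?_) (Subtype.ext h2)⟩
      change factorThruImage (p ≫ m) ≫ e.inv = p
      rw [← cancel_mono m]
      have h3 : m = e.hom ≫ image.ι (p ≫ m) := h2.symm
      calc (factorThruImage (p ≫ m) ≫ e.inv) ≫ m
          = (factorThruImage (p ≫ m) ≫ e.inv) ≫ e.hom ≫ image.ι (p ≫ m) :=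
            congrArg (fun z => (factorThruImage (p ≫ m) ≫ e.inv) ≫ z) h3
        _ = p ≫ m := by simp
  have h := natCard_sigma_const (α := α) (β := fun φ => (image φ.1 ≅ M)) (γ := Aut M)
    fun φ => isoEquivAut' φ.2.2.1.some
  rw [Nat.card_congr (Equiv.ofBijective F hF), Nat.card_prod] at h
  have h' : (Nat.card α : ℚ) * autCard M =
      (autCard M * hallNumber M N X) * (autCard M * hallNumber I M Y) := by
    rw [← card_epis, ← card_monos, autCard]
    exact_mod_cast h.symm
  have := (autCard_pos M).ne'
  refine mul_right_cancel₀ this (h'.trans ?_)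
  ring

/-- The short exact sequences `0 ⟶ I ⟶ E ⟶ N ⟶ 0` with fixed terms. -/
def ShortExactPairs (I E N : A) : Type v :=
  {q : (I ⟶ E) × (E ⟶ N) // ∃ w : q.1 ≫ q.2 = 0, (ShortComplex.mk q.1 q.2 w).ShortExact}

/-- A short exact sequence is a monomorphism together with an identification of its cokernel. -/
theorem card_shortExactPairs (I E N : A) :
    (Nat.card (ShortExactPairs I E N) : ℚ) = autCard N * autCard I * hallNumber N I E := by
  let α := {m : I ⟶ E // Mono m ∧ Nonempty (cokernel m ≅ N)}
  let F : (Σ m : α, (cokernel m.1 ≅ N)) → ShortExactPairs I E N :=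
    fun q => ⟨(q.1.1, cokernel.π q.1.1 ≫ q.2.hom), by simp, by
      have := q.1.2.1
      exact { exact := ShortComplex.exact_of_g_is_cokernel _
                (IsCokernel.cokernelIso q.1.1 _ (cokernelIsCokernel q.1.1) q.2 (by simp))
              mono_f := this
              epi_g := epi_comp _ _ }⟩
  have hF : Function.Bijective F := by
    constructor
    · rintro ⟨⟨m, hm⟩, e⟩ ⟨⟨m', hm'⟩, e'⟩ h
      have h1 : m = m' := congrArg (fun z => z.1.1) h
      subst h1
      have h2 : cokernel.π m ≫ e.hom = cokernel.π m ≫ e'.hom := congrArg (fun z => z.1.2) h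
      have h4 : e = e' := by
        ext1
        exact (cancel_epi _).1 h2
      subst h4
      rfl
    · rintro ⟨⟨i, p⟩, w, hS⟩
      have hi : Mono i := hS.mono_f
      let e : cokernel i ≅ N := (cokernelIsCokernel i).coconePointUniqueUpToIso hS.gIsCokernel
      have he : cokernel.π i ≫ e.hom = p :=
        (cokernelIsCokernel i).comp_coconePointUniqueUpToIso_hom hS.gIsCokernel .one
      exact ⟨⟨⟨i, hi, ⟨e⟩⟩, e⟩, Subtype.ext (Prod.ext rfl he)⟩
  have h := natCard_sigma_const (α := α) (β := fun m => (cokernel m.1 ≅ N)) (γ := Aut N)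
    fun m => isoEquivAut' m.2.2.some
  rw [Nat.card_congr (Equiv.ofBijective F hF)] at h
  have h' := card_monos N I E
  rw [h]
  push_cast
  rw [h', autCard, autCard]
  ring

theorem hallNumber_congr [∀ X Y : A, Finite (X ⟶ Y)] {X X' Y Y' L L' : A}
    (eX : X ≅ X') (eY : Y ≅ Y') (eL : L ≅ L') :
    hallNumber X Y L = hallNumber X' Y' L' := by
  have h := (autCard_pos Y').ne'
  refine mul_left_cancel₀ h ?_
  rw [← card_monos, ← autCard_congr eY, ← card_monos]
  congr 1
  refine Nat.card_congr ((eY.homCongr eL).subtypeEquiv fun m => ?_)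
  have e : cokernel ((eY.homCongr eL) m) ≅ cokernel m :=
    cokernelEpiComp _ _ ≪≫ cokernelCompIsIso _ _
  refine and_congr ⟨fun hm => ?_, fun hm => ?_⟩
    ⟨fun ⟨a⟩ => ⟨e ≪≫ a ≪≫ eX⟩, fun ⟨a⟩ => ⟨e.symm ≪≫ a ≪≫ eX.symm⟩⟩
  · simp only [Iso.homCongr_apply]
    infer_instance
  · have h2 : m = eY.hom ≫ (eY.homCongr eL) m ≫ eL.inv := by simp
    rw [h2]
    infer_instance

end

end

/-! ### Extension groups as morphism groups of the derived category -/

section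

section

variable {A : Type u} [Category.{v} A] [Abelian A]

/-- `Ext^n(X, Y)` as the group of morphisms from `X` placed in degree `i` to `Y` placed in degree
`j` when `i = j + n`. -/
def singleHomEquivExt [HasDerivedCategory.{w} A] [HasExt.{w'} A] (X Y : A) (i j : ℤ) (n : ℕ)
    (h : i = j + n) :
    ((singleFunctor A i).obj X ⟶ (singleFunctor A j).obj Y) ≃ Abelian.Ext.{w'} X Y n :=
  ((shiftEquiv (DerivedCategory A) i).fullyFaithfulFunctor.homEquiv.trans
    (Iso.homCongr (((singleFunctors A).shiftIso i 0 i (by lia)).app X)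
      (((singleFunctors A).shiftIso i (-n) j (by lia)).app Y ≪≫
        (((singleFunctors A).shiftIso n (-n) 0 (by lia)).app Y).symm))).trans
    Abelian.Ext.homEquiv.symm

/-- Finiteness of `Hom` and `Ext¹` and vanishing of the higher extension groups, expressed in the
derived category by morphisms between objects concentrated in one degree. -/
class IsDerivedHereditary (A : Type u) [Category.{v} A] [Abelian A] [HasDerivedCategory.{w} A] :
    Prop where
  finite_hom (X Y : A) : Finite (X ⟶ Y)
  finite_ext (i j : ℤ) (h : i = j + 1) (X Y : A) :
    Finite ((singleFunctor A i).obj X ⟶ (singleFunctor A j).obj Y)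
  subsingleton_hom (i j : ℤ) (h : j + 2 ≤ i) (X Y : A) :
    Subsingleton ((singleFunctor A i).obj X ⟶ (singleFunctor A j).obj Y)

/-- The hypothesis on the groups `Extⁿ` implies its formulation in the derived category. -/
theorem isDerivedHereditary [HasDerivedCategory.{w} A] [HasExt.{w'} A]
    [IsFinitaryHereditary.{w'} A] : IsDerivedHereditary A where
  finite_hom := IsFinitaryHereditary.finite_hom.{w'}
  finite_ext i j h X Y := by
    have := IsFinitaryHereditary.finite_ext_one.{w'} X Y
    exact Finite.of_equiv _ (singleHomEquivExt.{w, w'} X Y i j 1 (by lia)).symm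
  subsingleton_hom i j h X Y := by
    obtain ⟨n, hn⟩ := Int.eq_ofNat_of_zero_le (show 0 ≤ i - j by lia)
    have := IsFinitaryHereditary.subsingleton_ext.{w'} X Y n (by lia)
    exact (singleHomEquivExt.{w, w'} X Y i j n (by lia)).subsingleton

theorem natCard_single_hom_succ [HasDerivedCategory.{w} A] [HasExt.{w'} A] (X Y : A) (i j : ℤ)
    (h : i = j + 1) :
    Nat.card ((singleFunctor A i).obj X ⟶ (singleFunctor A j).obj Y) =
      Nat.card (Abelian.Ext.{w'} X Y 1) :=
  Nat.card_congr (singleHomEquivExt X Y i j 1 (by lia))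

variable [HasDerivedCategory.{w} A]

theorem subsingleton_single_hom_of_lt (X Y : A) (i j : ℤ) (h : i < j) :
    Subsingleton ((singleFunctor A i).obj X ⟶ (singleFunctor A j).obj Y) :=
  ⟨fun f g => (TStructure.t.zero f i j h).trans (TStructure.t.zero g i j h).symm⟩

theorem subsingleton_single_hom [IsDerivedHereditary A] (X Y : A) (i j : ℤ) (h : i ≠ j)
    (h' : i ≠ j + 1) : Subsingleton ((singleFunctor A i).obj X ⟶ (singleFunctor A j).obj Y) := by
  rcases lt_or_ge i j with h1 | h1
  · exact subsingleton_single_hom_of_lt X Y i j h1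
  · exact IsDerivedHereditary.subsingleton_hom i j (by lia) X Y

instance finite_single_hom [IsDerivedHereditary A] (X Y : A) (i j : ℤ) :
    Finite ((singleFunctor A i).obj X ⟶ (singleFunctor A j).obj Y) := by
  by_cases h : i = j
  · subst h
    have := IsDerivedHereditary.finite_hom X Y
    exact Finite.of_equiv _ (Functor.FullyFaithful.ofFullyFaithful (singleFunctor A i)).homEquiv
  · by_cases h' : i = j + 1
    · exact IsDerivedHereditary.finite_ext i j h' X Y
    · have := subsingleton_single_hom X Y i j h h'
      infer_instance

/-- The triangle in the derived category given by a short exact sequence placed in degree `i`. -/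
theorem exists_single_distTriang {S : ShortComplex A} (hS : S.ShortExact) (i : ℤ) :
    ∃ δ, Triangle.mk ((singleFunctor A i).map S.f) ((singleFunctor A i).map S.g) δ ∈
      distTriang (DerivedCategory A) :=
  ⟨triangleOfSESδ (hS.map_of_exact (HomologicalComplex.single A (ComplexShape.up ℤ) i)),
    triangleOfSES_distinguished
      (hS.map_of_exact (HomologicalComplex.single A (ComplexShape.up ℤ) i))⟩

theorem subsingleton_single_hom_shift [IsDerivedHereditary A] (X Y : A) (i j : ℤ)
    (h : j + 1 ≤ i) :
    Subsingleton ((singleFunctor A i).obj X ⟶ ((singleFunctor A j).obj Y)⟦(1 : ℤ)⟧) := by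
  have := IsDerivedHereditary.subsingleton_hom i (j - 1) (by lia) X Y
  exact ((Iso.refl _).homCongr
    (((singleFunctors A).shiftIso 1 (j - 1) j (by lia)).app Y)).subsingleton

theorem subsingleton_single_shift_hom [IsDerivedHereditary A] (X Y : A) (i j : ℤ)
    (h : j + 1 ≤ i) :
    Subsingleton (((singleFunctor A i).obj X)⟦(-1 : ℤ)⟧ ⟶ (singleFunctor A j).obj Y) := by
  have := IsDerivedHereditary.subsingleton_hom (i + 1) j (by lia) X Y
  exact ((((singleFunctors A).shiftIso (-1) (i + 1) i (by lia)).app X).homCongr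
    (Iso.refl _)).subsingleton

/-- Since `Ext²` vanishes, classes in `Ext¹` extend along monomorphisms. -/
theorem exists_extension_of_mono [IsDerivedHereditary A] {N X : A} (ι : N ⟶ X) [Mono ι] (I : A)
    (i j : ℤ) (h : i = j + 1) (e : (singleFunctor A i).obj N ⟶ (singleFunctor A j).obj I) :
    ∃ ε : (singleFunctor A i).obj X ⟶ (singleFunctor A j).obj I,
      (singleFunctor A i).map ι ≫ ε = e := by
  have hS : (ShortComplex.mk ι (cokernel.π ι) (by simp)).ShortExact :=
    { exact := ShortComplex.exact_cokernel ι
      mono_f := inferInstance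
      epi_g := by dsimp; infer_instance }
  obtain ⟨δ, hδ⟩ := exists_single_distTriang hS i
  obtain ⟨ε, hε⟩ := Triangle.yoneda_exact₂ _ (inv_rot_of_distTriang _ hδ) e
    ((subsingleton_single_shift_hom (cokernel ι) I i j (by lia)).elim _ _)
  exact ⟨ε, hε.symm⟩

/-- Since `Ext²` vanishes, classes in `Ext¹` lift along epimorphisms. -/
theorem exists_lift_of_epi [IsDerivedHereditary A] {Y I : A} (π : Y ⟶ I) [Epi π] (X : A)
    (i j : ℤ) (h : i = j + 1) (e : (singleFunctor A i).obj X ⟶ (singleFunctor A j).obj I) :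
    ∃ ε : (singleFunctor A i).obj X ⟶ (singleFunctor A j).obj Y,
      ε ≫ (singleFunctor A j).map π = e := by
  have hS : (ShortComplex.mk (kernel.ι π) π (by simp)).ShortExact :=
    { exact := ShortComplex.exact_kernel π
      mono_f := by dsimp; infer_instance
      epi_g := inferInstance }
  obtain ⟨δ, hδ⟩ := exists_single_distTriang hS j
  obtain ⟨ε, hε⟩ := Triangle.coyoneda_exact₃ _ hδ e
    ((subsingleton_single_hom_shift X (kernel π) i j (by lia)).elim _ _)
  exact ⟨ε, hε.symm⟩

/-- The preimage of a set under a surjective homomorphism, whose fibres are the cosets of the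
kernel. -/
theorem card_preimage_addMonoidHom {G H : Type*} [AddCommGroup G] [AddCommGroup H]
    (q : G →+ H) (hq : Function.Surjective q) (U : Set H) :
    Nat.card (q ⁻¹' U) * Nat.card H = Nat.card U * Nat.card G := by
  choose r hr using hq
  have e : ∀ a : H, {g // q g = a} ≃ q.ker := fun a =>
    { toFun := fun g => ⟨g.1 - r a, by simp [AddMonoidHom.mem_ker, g.2, hr]⟩
      invFun := fun k => ⟨k.1 + r a, by simp [AddMonoidHom.mem_ker.1 k.2, hr]⟩
      left_inv := fun g => by simp
      right_inv := fun g => by simp }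
  have h1 : Nat.card G = Nat.card H * Nat.card q.ker := by
    rw [← natCard_sigma_const e, Nat.card_congr (Equiv.sigmaFiberEquiv q)]
  have h2 : Nat.card (q ⁻¹' U) = Nat.card U * Nat.card q.ker := by
    rw [← natCard_sigma_const (fun a : U => e a)]
    refine Nat.card_congr ((Equiv.sigmaFiberEquiv (fun g : q ⁻¹' U => (⟨q g, g.2⟩ : U))).symm.trans
      (Equiv.sigmaCongrRight fun a => ?_))
    exact { toFun := fun g => ⟨g.1.1, congrArg Subtype.val g.2⟩
            invFun := fun g => ⟨⟨g.1, by
              rw [Set.mem_preimage, g.2]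
              exact a.2⟩, Subtype.ext g.2⟩
            left_inv := fun g => rfl
            right_inv := fun g => rfl }
  rw [h1, h2]
  ring

/-- The classes in `Ext¹(X, Y)` whose image in `Ext¹(N, I)` lies in a given set. -/
theorem card_ext_preimage [IsDerivedHereditary A] {N X Y I : A} (ι : N ⟶ X) [Mono ι] (π : Y ⟶ I)
    [Epi π] (i j : ℤ) (h : i = j + 1)
    (U : Set ((singleFunctor A i).obj N ⟶ (singleFunctor A j).obj I)) :
    Nat.card {ε : (singleFunctor A i).obj X ⟶ (singleFunctor A j).obj Y //
        (singleFunctor A i).map ι ≫ ε ≫ (singleFunctor A j).map π ∈ U} *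
      Nat.card ((singleFunctor A i).obj N ⟶ (singleFunctor A j).obj I) =
    Nat.card U * Nat.card ((singleFunctor A i).obj X ⟶ (singleFunctor A j).obj Y) := by
  refine card_preimage_addMonoidHom (AddMonoidHom.mk'
    (fun ε : (singleFunctor A i).obj X ⟶ (singleFunctor A j).obj Y =>
      (singleFunctor A i).map ι ≫ ε ≫ (singleFunctor A j).map π) (by simp)) (fun e => ?_) U
  obtain ⟨ε, hε⟩ := exists_extension_of_mono ι I i j h e
  obtain ⟨ε', hε'⟩ := exists_lift_of_epi π X i j h ε
  exact ⟨ε', by simp [hε', hε]⟩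

end

/-! ### Additivity of the Euler form -/

section

theorem card_eq_card_ker_mul_card_range {G H : Type*} [AddCommGroup G] [AddCommGroup H]
    (f : G →+ H) : Nat.card G = Nat.card f.ker * Nat.card f.range := by
  rw [← Nat.card_congr (QuotientAddGroup.quotientKerEquivRange f).toEquiv, mul_comm]
  exact AddSubgroup.card_eq_card_quotient_mul_card_addSubgroup f.ker

theorem card_six_term_exact {G₁ G₂ G₃ G₄ G₅ G₆ : Type*} [AddCommGroup G₁] [AddCommGroup G₂]
    [AddCommGroup G₃] [AddCommGroup G₄] [AddCommGroup G₅] [AddCommGroup G₆]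
    (f₁ : G₁ →+ G₂) (f₂ : G₂ →+ G₃) (f₃ : G₃ →+ G₄) (f₄ : G₄ →+ G₅) (f₅ : G₅ →+ G₆)
    (h₁ : Function.Injective f₁) (h₂ : f₁.range = f₂.ker) (h₃ : f₂.range = f₃.ker)
    (h₄ : f₃.range = f₄.ker) (h₅ : f₄.range = f₅.ker) (h₆ : Function.Surjective f₅) :
    Nat.card G₁ * Nat.card G₃ * Nat.card G₅ = Nat.card G₂ * Nat.card G₄ * Nat.card G₆ := by
  have e₁ : Nat.card G₁ = Nat.card f₁.range :=
    Nat.card_congr (AddMonoidHom.ofInjective h₁).toEquiv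
  have e₂ := card_eq_card_ker_mul_card_range f₂
  have e₃ := card_eq_card_ker_mul_card_range f₃
  have e₄ := card_eq_card_ker_mul_card_range f₄
  have e₅ := card_eq_card_ker_mul_card_range f₅
  have e₆ : Nat.card f₅.range = Nat.card G₆ := by
    rw [AddMonoidHom.range_eq_top.2 h₆]
    exact Nat.card_congr AddSubgroup.topEquiv.toEquiv
  rw [e₂, e₃, e₄, e₅, e₁, ← h₂, ← h₃, ← h₄, ← h₅, e₆]
  ring

variable {A : Type u} [Category.{v} A] [Abelian A] [HasExt.{w'} A]

theorem natCard_ext_zero (X Y : A) :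
    Nat.card (Abelian.Ext.{w'} X Y 0) = Nat.card (X ⟶ Y) :=
  Nat.card_congr Abelian.Ext.homEquiv₀

variable [IsFinitaryHereditary.{w'} A]

theorem natCard_hom_pos (X Y : A) : 0 < Nat.card (X ⟶ Y) := by
  have := IsFinitaryHereditary.finite_hom.{w'} X Y
  exact Nat.card_pos

theorem natCard_ext_one_pos (X Y : A) : 0 < Nat.card (Abelian.Ext.{w'} X Y 1) := by
  have := IsFinitaryHereditary.finite_ext_one.{w'} X Y
  exact Nat.card_pos

theorem euler_pos (X Y : A) : 0 < euler.{w'} X Y := by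
  have := natCard_hom_pos.{w'} X Y
  have := natCard_ext_one_pos.{w'} X Y
  unfold euler
  positivity

open Abelian in
theorem euler_additive_right (X : A) {S : ShortComplex A} (hS : S.ShortExact) :
    euler.{w'} X S.X₂ = euler.{w'} X S.X₁ * euler.{w'} X S.X₃ := by
  have hm := hS.mono_f
  have h := card_six_term_exact
    ((Ext.mk₀ S.f).postcomp X (add_zero 0)) ((Ext.mk₀ S.g).postcomp X (add_zero 0))
    (hS.extClass.postcomp X (zero_add 1))
    ((Ext.mk₀ S.f).postcomp X (add_zero 1)) ((Ext.mk₀ S.g).postcomp X (add_zero 1))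
    (Ext.postcomp_mk₀_injective_of_mono X S.f)
    (by
      refine (AddMonoidHom.exact_iff.1 ?_).symm
      exact (ShortComplex.ab_exact_iff_function_exact _).1 (Ext.covariant_sequence_exact₂' X hS 0))
    (by
      refine (AddMonoidHom.exact_iff.1 ?_).symm
      exact (ShortComplex.ab_exact_iff_function_exact _).1
        (Ext.covariant_sequence_exact₃' X hS 0 1 rfl))
    (by
      refine (AddMonoidHom.exact_iff.1 ?_).symm
      exact (ShortComplex.ab_exact_iff_function_exact _).1
        (Ext.covariant_sequence_exact₁' X hS 0 1 rfl))
    (by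
      refine (AddMonoidHom.exact_iff.1 ?_).symm
      exact (ShortComplex.ab_exact_iff_function_exact _).1 (Ext.covariant_sequence_exact₂' X hS 1))
    (fun x => Ext.covariant_sequence_exact₃ X hS x (n₁ := 2) rfl
      ((IsFinitaryHereditary.subsingleton_ext X S.X₁ 2 le_rfl).elim _ _))
  simp only [natCard_ext_zero] at h
  have h1 := natCard_ext_one_pos.{w'} X S.X₁
  have h2 := natCard_ext_one_pos.{w'} X S.X₂
  have h3 := natCard_ext_one_pos.{w'} X S.X₃
  unfold euler
  rw [div_mul_div_comm, div_eq_div_iff (by positivity) (by positivity)]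
  exact_mod_cast (by linarith : _ = _)

open Abelian in
theorem euler_additive_left {S : ShortComplex A} (hS : S.ShortExact) (Y : A) :
    euler.{w'} S.X₂ Y = euler.{w'} S.X₁ Y * euler.{w'} S.X₃ Y := by
  have hm := hS.epi_g
  have h := card_six_term_exact
    ((Ext.mk₀ S.g).precomp Y (zero_add 0)) ((Ext.mk₀ S.f).precomp Y (zero_add 0))
    (hS.extClass.precomp Y (add_zero 1))
    ((Ext.mk₀ S.g).precomp Y (zero_add 1)) ((Ext.mk₀ S.f).precomp Y (zero_add 1))
    (Ext.precomp_mk₀_injective_of_epi Y S.g)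
    (by
      refine (AddMonoidHom.exact_iff.1 ?_).symm
      exact (ShortComplex.ab_exact_iff_function_exact _).1
        (Ext.contravariant_sequence_exact₂' hS Y 0))
    (by
      refine (AddMonoidHom.exact_iff.1 ?_).symm
      exact (ShortComplex.ab_exact_iff_function_exact _).1
        (Ext.contravariant_sequence_exact₁' hS Y 0 1 rfl))
    (by
      refine (AddMonoidHom.exact_iff.1 ?_).symm
      exact (ShortComplex.ab_exact_iff_function_exact _).1
        (Ext.contravariant_sequence_exact₃' hS Y 0 1 rfl))
    (by
      refine (AddMonoidHom.exact_iff.1 ?_).symm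
      exact (ShortComplex.ab_exact_iff_function_exact _).1
        (Ext.contravariant_sequence_exact₂' hS Y 1))
    (fun x => Ext.contravariant_sequence_exact₁ hS Y x (n₁ := 2) rfl
      ((IsFinitaryHereditary.subsingleton_ext S.X₃ Y 2 le_rfl).elim _ _))
  simp only [natCard_ext_zero] at h
  have h1 := natCard_ext_one_pos.{w'} S.X₁ Y
  have h2 := natCard_ext_one_pos.{w'} S.X₂ Y
  have h3 := natCard_ext_one_pos.{w'} S.X₃ Y
  unfold euler
  rw [div_mul_div_comm, div_eq_div_iff (by positivity) (by positivity)]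
  exact_mod_cast (by linarith : _ = _)

end

end

/-! ### Riedtmann's formula -/

section

section

variable {T : Type u} [Category.{v} T] [HasZeroObject T] [Preadditive T] [HasShift T ℤ]
  [∀ n : ℤ, (shiftFunctor T n).Additive] [Pretriangulated T]

theorem coyoneda_exact₂_mk {X Y Z W : T} {f : X ⟶ Y} {g : Y ⟶ Z} {h : Z ⟶ X⟦(1 : ℤ)⟧}
    (hT : Triangle.mk f g h ∈ distTriang T) (a : W ⟶ Y) (ha : a ≫ g = 0) : ∃ b, a = b ≫ f :=
  Triangle.coyoneda_exact₂ _ hT a ha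

theorem yoneda_exact₃_mk {X Y Z W : T} {f : X ⟶ Y} {g : Y ⟶ Z} {h : Z ⟶ X⟦(1 : ℤ)⟧}
    (hT : Triangle.mk f g h ∈ distTriang T) (a : Z ⟶ W) (ha : g ≫ a = 0) : ∃ b, a = h ≫ b :=
  Triangle.yoneda_exact₃ _ hT a ha

theorem complete_mk {X Y Z X' Y' Z' : T} {f : X ⟶ Y} {g : Y ⟶ Z} {h : Z ⟶ X⟦(1 : ℤ)⟧}
    {f' : X' ⟶ Y'} {g' : Y' ⟶ Z'} {h' : Z' ⟶ X'⟦(1 : ℤ)⟧}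
    (hT : Triangle.mk f g h ∈ distTriang T) (hT' : Triangle.mk f' g' h' ∈ distTriang T)
    (a : X ⟶ X') (b : Y ⟶ Y') (hab : f ≫ b = a ≫ f') :
    ∃ c : Z ⟶ Z', g ≫ c = b ≫ g' ∧ h ≫ a⟦1⟧' = c ≫ h' :=
  complete_distinguished_triangle_morphism _ _ hT hT' a b hab

theorem exists_iso_cone_mk {X Y Z Z' : T} {f : X ⟶ Y} {g : Y ⟶ Z} {h : Z ⟶ X⟦(1 : ℤ)⟧}
    {g' : Y ⟶ Z'} {h' : Z' ⟶ X⟦(1 : ℤ)⟧}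
    (hT : Triangle.mk f g h ∈ distTriang T) (hT' : Triangle.mk f g' h' ∈ distTriang T) :
    ∃ c : Z ≅ Z', g ≫ c.hom = g' ∧ h = c.hom ≫ h' := by
  let e := isoTriangleOfIso₁₂ _ _ hT hT' (Iso.refl X) (Iso.refl Y)
    ((Category.comp_id f).trans (Category.id_comp f).symm)
  refine ⟨Triangle.π₃.mapIso e, ?_, ?_⟩
  · exact e.hom.comm₂.trans (Category.id_comp g')
  · exact ((Category.comp_id h).symm.trans
      (congrArg (h ≫ ·) (CategoryTheory.Functor.map_id _ X)).symm).trans e.hom.comm₃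

theorem distTriang_mk_congr₃ {X Y Z Z' : T} {f : X ⟶ Y} {g : Y ⟶ Z} {h : Z ⟶ X⟦(1 : ℤ)⟧}
    (hT : Triangle.mk f g h ∈ distTriang T) (c : Z ≅ Z') {g' : Y ⟶ Z'} {h' : Z' ⟶ X⟦(1 : ℤ)⟧}
    (hg : g ≫ c.hom = g') (hh : h = c.hom ≫ h') : Triangle.mk f g' h' ∈ distTriang T :=
  isomorphic_distinguished _ hT _
    (Triangle.isoMk _ _ (Iso.refl X) (Iso.refl Y) c
      ((Category.comp_id f).trans (Category.id_comp f).symm)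
      (hg.trans (Category.id_comp g').symm)
      ((congrArg (h ≫ ·) (CategoryTheory.Functor.map_id _ X)).trans ((Category.comp_id h).trans hh))).symm

theorem rotate_mk {X Y Z : T} {f : X ⟶ Y} {g : Y ⟶ Z} {h : Z ⟶ X⟦(1 : ℤ)⟧} :
    Triangle.mk f g h ∈ distTriang T ↔ Triangle.mk g h (-f⟦1⟧') ∈ distTriang T :=
  rotate_distinguished_triangle (Triangle.mk f g h)

theorem distTriang_mk_iso₃ {X Y Z Z' : T} {f : X ⟶ Y} {g : Y ⟶ Z} {h : Z ⟶ X⟦(1 : ℤ)⟧}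
    (c : Z ≅ Z') : Triangle.mk f g h ∈ distTriang T ↔
      Triangle.mk f (g ≫ c.hom) (c.inv ≫ h) ∈ distTriang T :=
  ⟨fun hT => distTriang_mk_congr₃ hT c rfl (by simp),
    fun hT => distTriang_mk_congr₃ hT c.symm (by simp) (by simp)⟩

end

section

variable {A : Type u} [Category.{v} A] [Abelian A] [HasDerivedCategory.{w} A]

/-- The shift of an object placed in degree `j + 1` is the object placed in degree `j`. -/
def singleShiftIso (X : A) (i j : ℤ) (h : i = j + 1) :
    ((singleFunctor A i).obj X)⟦(1 : ℤ)⟧ ≅ (singleFunctor A j).obj X :=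
  ((singleFunctors A).shiftIso 1 j i (by lia)).app X

/-- `e : Ext¹(N, I)`, as a morphism from `N` placed in degree `i = j + 1` to `I` placed in
degree `j`, is the class of the extension `0 ⟶ I ⟶ E ⟶ N ⟶ 0` given by `a` and `p`. -/
def IsExtClass {I E N : A} {i j : ℤ} (h : i = j + 1)
    (e : (singleFunctor A i).obj N ⟶ (singleFunctor A j).obj I) (a : I ⟶ E) (p : E ⟶ N) : Prop :=
  Triangle.mk e ((singleFunctor A j).map a)
    ((singleFunctor A j).map p ≫ (singleShiftIso N i j h).inv) ∈ distTriang (DerivedCategory A)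

variable {I E N : A} {i j : ℤ} (h : i = j + 1)

/-- The rotated form, in which the extension is a triangle of objects in degree `j`. -/
theorem isExtClass_iff (e : (singleFunctor A i).obj N ⟶ (singleFunctor A j).obj I)
    (a : I ⟶ E) (p : E ⟶ N) :
    IsExtClass h e a p ↔
      Triangle.mk ((singleFunctor A j).map a) ((singleFunctor A j).map p)
        ((singleShiftIso N i j h).inv ≫ (-e⟦(1 : ℤ)⟧')) ∈ distTriang (DerivedCategory A) := by
  rw [IsExtClass, rotate_mk, distTriang_mk_iso₃ (singleShiftIso N i j h)]
  simp

theorem IsExtClass.shortExact {e : (singleFunctor A i).obj N ⟶ (singleFunctor A j).obj I}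
    {a : I ⟶ E} {p : E ⟶ N} (he : IsExtClass h e a p) :
    ∃ w : a ≫ p = 0, (ShortComplex.mk a p w).ShortExact := by
  have he' := (isExtClass_iff h e a p).1 he
  have w : a ≫ p = 0 := (singleFunctor A j).map_injective (by
    rw [Functor.map_comp, Functor.map_zero]
    exact comp_distTriang_mor_zero₁₂ _ he')
  have hm : Mono a := by
    refine Preadditive.mono_of_cancel_zero _ fun {G} z hz => ?_
    obtain ⟨b, hb⟩ := coyoneda_exact₂_mk he ((singleFunctor A j).map z)
      (by rw [← Functor.map_comp, hz, Functor.map_zero])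
    have := subsingleton_single_hom_of_lt G N j i (by lia)
    rw [Subsingleton.elim b 0, zero_comp] at hb
    exact (singleFunctor A j).map_injective (by simp [hb])
  have hp : Epi p := by
    refine Preadditive.epi_of_cancel_zero _ fun {G} z hz => ?_
    obtain ⟨b, hb⟩ := yoneda_exact₃_mk he' ((singleFunctor A j).map z)
      (by rw [← Functor.map_comp, hz, Functor.map_zero])
    have hs := subsingleton_single_hom_of_lt I G (j - 1) j (by lia)
    have hb' : (singleShiftIso I j (j - 1) (by lia)).inv ≫ b = 0 := Subsingleton.elim _ _
    have hb0 : b = 0 := by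
      rw [← cancel_epi (singleShiftIso I j (j - 1) (by lia)).inv, hb', comp_zero]
    exact (singleFunctor A j).map_injective (by simp [hb, hb0])
  refine ⟨w, ?_⟩
  have lift : ∀ {G : A} (z : G ⟶ E), z ≫ p = 0 → ∃ y : G ⟶ I, y ≫ a = z := fun {G} z hz => by
    obtain ⟨b, hb⟩ := coyoneda_exact₂_mk he' ((singleFunctor A j).map z)
      (by rw [← Functor.map_comp, hz, Functor.map_zero])
    obtain ⟨y, rfl⟩ := (singleFunctor A j).map_surjective b
    exact ⟨y, (singleFunctor A j).map_injective (by rw [Functor.map_comp, hb])⟩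
  exact
    { exact := ShortComplex.exact_of_f_is_kernel _ (KernelFork.IsLimit.ofι _ _
        (fun z hz => (lift z hz).choose) (fun z hz => (lift z hz).choose_spec)
        fun z hz m hm' => by
          rw [← cancel_mono a, (lift z hz).choose_spec]
          exact hm')
      mono_f := hm
      epi_g := hp }

theorem exists_isExtClass {a : I ⟶ E} {p : E ⟶ N} {w : a ≫ p = 0}
    (hS : (ShortComplex.mk a p w).ShortExact) :
    ∃ e : (singleFunctor A i).obj N ⟶ (singleFunctor A j).obj I, IsExtClass h e a p := by
  obtain ⟨δ, hδ⟩ := exists_single_distTriang hS j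
  obtain ⟨e, he⟩ := (shiftFunctor (DerivedCategory A) (1 : ℤ)).map_surjective
    (-((singleShiftIso N i j h).hom ≫ δ))
  refine ⟨e, (isExtClass_iff h e a p).2 ?_⟩
  rw [he]
  simpa using hδ

/-- The class of an extension is determined by its two morphisms: a morphism between the two
triangles that is the identity of `I` and `E` is the identity of `N`, since `p` is epi. -/
theorem isExtClass_unique {a : I ⟶ E} {p : E ⟶ N}
    {e e' : (singleFunctor A i).obj N ⟶ (singleFunctor A j).obj I}
    (he : IsExtClass h e a p) (he' : IsExtClass h e' a p) : e = e' := by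
  obtain ⟨w, hS⟩ := he.shortExact
  have hp : Epi p := hS.epi_g
  obtain ⟨c, hc, hc'⟩ := complete_mk ((isExtClass_iff h e a p).1 he)
    ((isExtClass_iff h e' a p).1 he') (𝟙 _) (𝟙 _) (by simp)
  obtain ⟨c, rfl⟩ := (singleFunctor A j).map_surjective c
  have h1 : c = 𝟙 N := by
    rw [← cancel_epi p]
    refine (singleFunctor A j).map_injective ?_
    simpa using hc
  subst h1
  refine (shiftFunctor (DerivedCategory A) (1 : ℤ)).map_injective ?_
  simpa using hc'

theorem IsExtClass.comp_iso {a : I ⟶ E} {p : E ⟶ N}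
    {e : (singleFunctor A i).obj N ⟶ (singleFunctor A j).obj I}
    (he : IsExtClass h e a p) {E' : A} (α : E ≅ E') :
    IsExtClass h e (a ≫ α.hom) (α.inv ≫ p) :=
  distTriang_mk_congr₃ he ((singleFunctor A j).mapIso α) (by simp) (by simp)

theorem IsExtClass.exists_iso {a a' : I ⟶ E} {p p' : E ⟶ N}
    {e : (singleFunctor A i).obj N ⟶ (singleFunctor A j).obj I}
    (he : IsExtClass h e a p) (he' : IsExtClass h e a' p') :
    ∃ α : E ≅ E, a ≫ α.hom = a' ∧ α.inv ≫ p = p' := by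
  obtain ⟨c, hc, hc'⟩ := exists_iso_cone_mk he he'
  refine ⟨(singleFunctor A j).preimageIso c, ?_, ?_⟩
  · exact (singleFunctor A j).map_injective (by simpa using hc)
  · refine (singleFunctor A j).map_injective ?_
    rw [← cancel_mono (singleShiftIso N i j h).inv]
    simp [hc']

theorem mem_homWithCone_iff (e : (singleFunctor A i).obj N ⟶ (singleFunctor A j).obj I) :
    e ∈ homWithCone _ _ ((singleFunctor A j).obj E) ↔
      ∃ (a : I ⟶ E) (p : E ⟶ N), IsExtClass h e a p := by
  constructor
  · rintro ⟨g, k, hT⟩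
    obtain ⟨a, rfl⟩ := (singleFunctor A j).map_surjective g
    obtain ⟨p, hp⟩ := (singleFunctor A j).map_surjective (k ≫ (singleShiftIso N i j h).hom)
    refine ⟨a, p, ?_⟩
    rw [IsExtClass, hp]
    simpa using hT
  · rintro ⟨a, p, hT⟩
    exact ⟨_, _, hT⟩

/-- The automorphisms of the middle term `E` of an extension `0 ⟶ I ⟶ E ⟶ N ⟶ 0` that induce the
identity of `I` and of `N` are the `1 + p v a` for `v : N ⟶ I`. -/
def unipotentAut (a : I ⟶ E) (p : E ⟶ N) (w : a ≫ p = 0) (v : N ⟶ I) : E ≅ E where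
  hom := 𝟙 E + p ≫ v ≫ a
  inv := 𝟙 E - p ≫ v ≫ a
  hom_inv_id := by simp [reassoc_of% w]
  inv_hom_id := by simp [reassoc_of% w]

/-- Riedtmann's formula: the number of classes in `Ext¹(N, I)` with middle term `E`. -/
theorem card_homWithCone_single {I E N : A} {i j : ℤ} (h : i = j + 1) :
    Nat.card (homWithCone ((singleFunctor A i).obj N) ((singleFunctor A j).obj I)
      ((singleFunctor A j).obj E)) * Nat.card (E ≅ E) =
      Nat.card (ShortExactPairs I E N) * Nat.card (N ⟶ I) := by
  let H := homWithCone ((singleFunctor A i).obj N) ((singleFunctor A j).obj I)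
      ((singleFunctor A j).obj E)
  choose a p hap using fun e : H => (mem_homWithCone_iff h e.1).1 e.2
  let G : H × (E ≅ E) → ShortExactPairs I E N := fun q =>
    ⟨(a q.1 ≫ q.2.hom, q.2.inv ≫ p q.1), ((hap q.1).comp_iso h q.2).shortExact⟩
  have hG : ∀ q : ShortExactPairs I E N, ∃ e : H, IsExtClass h e.1 q.1.1 q.1.2 ∧
      ∃ α : E ≅ E, G (e, α) = q := fun q => by
    obtain ⟨w, hS⟩ := q.2
    obtain ⟨e, he⟩ := exists_isExtClass h hS
    let e' : H := ⟨e, (mem_homWithCone_iff h e).2 ⟨_, _, he⟩⟩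
    obtain ⟨α, h1, h2⟩ := (hap e').exists_iso h he
    exact ⟨e', he, α, Subtype.ext (Prod.ext h1 h2)⟩
  choose e he α hα using hG
  have key : ∀ q : ShortExactPairs I E N, Nonempty ({x // G x = q} ≃ (N ⟶ I)) := fun q => by
    obtain ⟨w, hS⟩ := q.2
    have hm : Mono q.1.1 := hS.mono_f
    have hp : Epi q.1.2 := hS.epi_g
    have h1 : a (e q) ≫ (α q).hom = q.1.1 := congrArg (fun z => z.1.1) (hα q)
    have h2 : (α q).inv ≫ p (e q) = q.1.2 := congrArg (fun z => z.1.2) (hα q)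
    let F : (N ⟶ I) → {x // G x = q} := fun v =>
      ⟨(e q, α q ≪≫ unipotentAut q.1.1 q.1.2 w v), by
        refine Subtype.ext (Prod.ext ?_ ?_)
        · change a (e q) ≫ (α q).hom ≫ (𝟙 E + q.1.2 ≫ v ≫ q.1.1) = q.1.1
          rw [reassoc_of% h1]
          simp [reassoc_of% w]
        · change ((𝟙 E - q.1.2 ≫ v ≫ q.1.1) ≫ (α q).inv) ≫ p (e q) = q.1.2
          rw [Category.assoc, h2]
          simp [w]⟩
    refine ⟨(Equiv.ofBijective F ⟨fun v v' hv => ?_, ?_⟩).symm⟩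
    · have h3 : (α q).hom ≫ (𝟙 E + q.1.2 ≫ v ≫ q.1.1) =
          (α q).hom ≫ (𝟙 E + q.1.2 ≫ v' ≫ q.1.1) := congrArg (fun z => z.1.2.hom) hv
      rw [cancel_epi, add_right_inj, cancel_epi, cancel_mono] at h3
      exact h3
    · rintro ⟨⟨e', β⟩, hβ⟩
      have h3 : a e' ≫ β.hom = q.1.1 := congrArg (fun z => z.1.1) hβ
      have h4 : β.inv ≫ p e' = q.1.2 := congrArg (fun z => z.1.2) hβ
      have h5 : e' = e q := Subtype.ext (isExtClass_unique h (by
        have := (hap e').comp_iso h β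
        rwa [h3, h4] at this) (he q))
      subst h5
      -- The difference of two automorphisms over `q` vanishes on `I` and maps to `0` in `N`.
      have h6 : q.1.1 ≫ ((α q).inv ≫ β.hom - 𝟙 E) = 0 := by
        have h7 : q.1.1 ≫ (α q).inv = a (e q) := by rw [← h1]; simp
        rw [Preadditive.comp_sub, reassoc_of% h7, h3, Category.comp_id, sub_self]
      obtain ⟨x, hx⟩ : ∃ x : N ⟶ E, q.1.2 ≫ x = (α q).inv ≫ β.hom - 𝟙 E :=
        ⟨hS.gIsCokernel.desc (CokernelCofork.ofπ _ h6),
          hS.gIsCokernel.fac (CokernelCofork.ofπ _ h6) .one⟩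
      have h7 : x ≫ q.1.2 = 0 := by
        have h8 : β.hom ≫ q.1.2 = p (e q) := by rw [← h4]; simp
        rw [← cancel_epi q.1.2, reassoc_of% hx, Preadditive.sub_comp, Category.assoc, h8, h2]
        simp
      obtain ⟨v, hv⟩ : ∃ v : N ⟶ I, v ≫ q.1.1 = x :=
        ⟨hS.fIsKernel.lift (KernelFork.ofι _ h7),
          hS.fIsKernel.fac (KernelFork.ofι _ h7) .zero⟩
      refine ⟨v, Subtype.ext (Prod.ext rfl (Iso.ext ?_))⟩
      change (α q).hom ≫ (𝟙 E + q.1.2 ≫ v ≫ q.1.1) = β.hom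
      rw [hv, hx]
      simp
  have h1 := natCard_sigma_const (fun q => (key q).some)
  rw [← h1, ← Nat.card_prod]
  exact Nat.card_congr (Equiv.sigmaFiberEquiv G).symm

theorem card_homWithCone_single_eq [IsDerivedHereditary A] {I E N : A} {i j : ℤ}
    (h : i = j + 1) :
    (Nat.card (homWithCone ((singleFunctor A i).obj N) ((singleFunctor A j).obj I)
      ((singleFunctor A j).obj E)) : ℚ) =
      autCard N * autCard I * hallNumber N I E / autCard E * Nat.card (N ⟶ I) := by
  have := IsDerivedHereditary.finite_hom E E
  have h1 := (autCard_pos E).ne'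
  rw [← card_shortExactPairs, div_mul_eq_mul_div, eq_div_iff h1]
  have h2 := card_homWithCone_single (A := A) (I := I) (E := E) (N := N) h
  unfold autCard
  exact_mod_cast h2

end

end

/-! ### Objects of the derived category split into their cohomology -/

section

section

variable {A : Type u} [Category.{v} A] [Abelian A]
  (K : CochainComplex A ℤ) (hd : ∀ i j, K.d i j = 0) (i j : ℤ)

/-- The inclusion of the component in degree `i` of a complex with zero differential. -/
def fromComponent : (CochainComplex.singleFunctor A i).obj (K.X i) ⟶ K :=
  HomologicalComplex.mkHomFromSingle (𝟙 (K.X i)) (by simp [hd])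

/-- The projection to the component in degree `i` of a complex with zero differential. -/
def toComponent : K ⟶ (CochainComplex.singleFunctor A i).obj (K.X i) :=
  HomologicalComplex.mkHomToSingle (𝟙 (K.X i)) (by simp [hd])

theorem fromComponent_toComponent : fromComponent K hd i ≫ toComponent K hd i = 𝟙 _ := by
  apply HomologicalComplex.from_single_hom_ext
  refine (congrArg₂ (· ≫ ·) (HomologicalComplex.mkHomFromSingle_f _ _)
    (HomologicalComplex.mkHomToSingle_f _ _)).trans ?_
  simp
  rfl

theorem fromComponent_toComponent_ne (h : i ≠ j) :
    fromComponent K hd i ≫ toComponent K hd j = 0 := by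
  apply HomologicalComplex.from_single_hom_ext
  exact (HomologicalComplex.isZero_single_obj_X (ComplexShape.up ℤ) j _ i h).eq_of_tgt _ _

theorem sum_toComponent_fromComponent (s : Finset ℤ) (hs : ∀ i ∉ s, IsZero (K.X i)) :
    ∑ i ∈ s, toComponent K hd i ≫ fromComponent K hd i = 𝟙 K := by
  ext i
  change (HomologicalComplex.eval A (ComplexShape.up ℤ) i).map _ = _
  rw [Functor.map_sum]
  by_cases hi : i ∈ s
  · rw [Finset.sum_eq_single_of_mem i hi]
    · refine (congrArg₂ (· ≫ ·) (HomologicalComplex.mkHomToSingle_f _ _)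
        (HomologicalComplex.mkHomFromSingle_f _ _)).trans ?_
      simp
    · intro j _ hj
      change (toComponent K hd j).f i ≫ (fromComponent K hd j).f i = 0
      exact (congrArg (· ≫ _) ((HomologicalComplex.isZero_single_obj_X
        (ComplexShape.up ℤ) j (K.X j) i hj.symm).eq_of_tgt _ 0)).trans zero_comp
  · exact (hs i hi).eq_of_tgt _ _

end

variable {A : Type u} [Category.{v} A] [Abelian A] [HasDerivedCategory.{w} A]

/-- A decomposition of an object `X` of the derived category as the direct sum of the objects
`x i` placed in degree `i`, finitely many of which are nonzero. -/
structure FormalDecomp (X : DerivedCategory A) (x : ℤ → A) where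
  /-- the inclusion of the summand in degree `i` -/
  ι (i : ℤ) : (singleFunctor A i).obj (x i) ⟶ X
  /-- the projection to the summand in degree `i` -/
  π (i : ℤ) : X ⟶ (singleFunctor A i).obj (x i)
  ι_π (i : ℤ) : ι i ≫ π i = 𝟙 _
  ι_π_ne (i j : ℤ) (h : i ≠ j) : ι i ≫ π j = 0
  /-- a finite set of degrees containing those of the nonzero summands -/
  supp : Finset ℤ
  isZero (i : ℤ) (h : i ∉ supp) : IsZero (x i)
  total : ∑ i ∈ supp, π i ≫ ι i = 𝟙 X

namespace FormalDecomp

variable {X Y Z : DerivedCategory A} {x y z : ℤ → A}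

theorem ι_π_assoc (d : FormalDecomp X x) (i : ℤ) {W : DerivedCategory A}
    (h : (singleFunctor A i).obj (x i) ⟶ W) : d.ι i ≫ d.π i ≫ h = h := by
  rw [← Category.assoc, d.ι_π, Category.id_comp]

theorem ι_π_ne_assoc (d : FormalDecomp X x) (i j : ℤ) (hij : i ≠ j) {W : DerivedCategory A}
    (h : (singleFunctor A j).obj (x j) ⟶ W) : d.ι i ≫ d.π j ≫ h = 0 ≫ h := by
  rw [← Category.assoc, d.ι_π_ne i j hij]

theorem total_of_subset (d : FormalDecomp X x) {s : Finset ℤ} (hs : d.supp ⊆ s) :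
    ∑ i ∈ s, d.π i ≫ d.ι i = 𝟙 X := by
  rw [← d.total]
  refine (Finset.sum_subset hs fun i _ hi => ?_).symm
  rw [((singleFunctor A i).map_isZero (d.isZero i hi)).eq_of_tgt (d.π i) 0, zero_comp]

/-- Two morphisms with the same matrix are equal. -/
theorem hom_ext (dX : FormalDecomp X x) (dY : FormalDecomp Y y) {f g : X ⟶ Y}
    (h : ∀ i j, dX.ι i ≫ f ≫ dY.π j = dX.ι i ≫ g ≫ dY.π j) : f = g := by
  have h1 : ∀ f : X ⟶ Y, f = ∑ i ∈ dX.supp, ∑ j ∈ dY.supp,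
      dX.π i ≫ (dX.ι i ≫ f ≫ dY.π j) ≫ dY.ι j := fun f => by
    calc f = (∑ i ∈ dX.supp, dX.π i ≫ dX.ι i) ≫ f ≫ (∑ j ∈ dY.supp, dY.π j ≫ dY.ι j) := by
            rw [dX.total, dY.total]; simp
      _ = _ := by
            simp only [Preadditive.sum_comp, Preadditive.comp_sum, Category.assoc]
            exact Finset.sum_comm
  rw [h1 f, h1 g]
  simp only [h]

theorem to_ext (dY : FormalDecomp Y y) {X : DerivedCategory A} {f g : X ⟶ Y}
    (h : ∀ j, f ≫ dY.π j = g ≫ dY.π j) : f = g := by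
  have h1 : ∀ f : X ⟶ Y, f = ∑ j ∈ dY.supp, (f ≫ dY.π j) ≫ dY.ι j := fun f => by
    conv_lhs => rw [← Category.comp_id f, ← dY.total]
    simp only [Preadditive.comp_sum, Category.assoc]
  rw [h1 f, h1 g]
  simp only [h]

/-- The identity is the sum of the projectors even after an additive functor such as the shift. -/
theorem to_shift_ext (dY : FormalDecomp Y y) {X : DerivedCategory A} {f g : X ⟶ Y⟦(1 : ℤ)⟧}
    (h : ∀ j, f ≫ (dY.π j)⟦(1 : ℤ)⟧' = g ≫ (dY.π j)⟦(1 : ℤ)⟧') : f = g := by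
  have h0 : ∑ j ∈ dY.supp, (dY.π j)⟦(1 : ℤ)⟧' ≫ (dY.ι j)⟦(1 : ℤ)⟧' = 𝟙 (Y⟦(1 : ℤ)⟧) := by
    simp only [← Functor.map_comp]
    rw [← Functor.map_sum, dY.total, CategoryTheory.Functor.map_id]
  have h1 : ∀ f : X ⟶ Y⟦(1 : ℤ)⟧, f = ∑ j ∈ dY.supp, (f ≫ (dY.π j)⟦(1 : ℤ)⟧') ≫
      (dY.ι j)⟦(1 : ℤ)⟧' := fun f => by
    conv_lhs => rw [← Category.comp_id f, ← h0]
    simp only [Preadditive.comp_sum, Category.assoc]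
  rw [h1 f, h1 g]
  simp only [h]

/-- Transport of a decomposition along isomorphisms of the object and of the summands. -/
def congr (d : FormalDecomp X x) (e : X ≅ Y) (a : ∀ i, x i ≅ y i) : FormalDecomp Y y where
  ι i := (singleFunctor A i).map (a i).inv ≫ d.ι i ≫ e.hom
  π i := e.inv ≫ d.π i ≫ (singleFunctor A i).map (a i).hom
  ι_π i := by simp [d.ι_π_assoc, ← Functor.map_comp]
  ι_π_ne i j h := by simp [d.ι_π_ne_assoc i j h]
  supp := d.supp
  isZero i h := (d.isZero i h).of_iso (a i).symm
  total := by
    have : ∀ i, (e.inv ≫ d.π i ≫ (singleFunctor A i).map (a i).hom) ≫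
        (singleFunctor A i).map (a i).inv ≫ d.ι i ≫ e.hom = e.inv ≫ (d.π i ≫ d.ι i) ≫ e.hom :=
      fun i => by
        simp only [Category.assoc]
        rw [← Functor.map_comp_assoc, Iso.hom_inv_id, CategoryTheory.Functor.map_id,
          Category.id_comp]
    simp only [this]
    rw [← Preadditive.comp_sum, ← Preadditive.sum_comp, d.total]
    simp

/-- Objects with decompositions into the same summands are isomorphic. -/
def iso (dX : FormalDecomp X x) (dY : FormalDecomp Y x) : X ≅ Y where
  hom := ∑ i ∈ dX.supp ∪ dY.supp, dX.π i ≫ dY.ι i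
  inv := ∑ i ∈ dX.supp ∪ dY.supp, dY.π i ≫ dX.ι i
  hom_inv_id := by
    rw [← dX.total_of_subset (s := dX.supp ∪ dY.supp) Finset.subset_union_left]
    simp only [Preadditive.sum_comp, Preadditive.comp_sum, Category.assoc]
    refine Finset.sum_congr rfl fun i hi => ?_
    rw [Finset.sum_eq_single_of_mem i hi fun j _ hj => by
      rw [dY.ι_π_ne_assoc j i hj, zero_comp, comp_zero], dY.ι_π_assoc]
  inv_hom_id := by
    rw [← dY.total_of_subset (s := dX.supp ∪ dY.supp) Finset.subset_union_right]
    simp only [Preadditive.sum_comp, Preadditive.comp_sum, Category.assoc]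
    refine Finset.sum_congr rfl fun i hi => ?_
    rw [Finset.sum_eq_single_of_mem i hi fun j _ hj => by
      rw [dX.ι_π_ne_assoc j i hj, zero_comp, comp_zero], dX.ι_π_assoc]

/-- The decomposition of a direct sum. -/
def biprod (dX : FormalDecomp X x) (dY : FormalDecomp Y y) :
    FormalDecomp (X ⊞ Y) (fun i => x i ⊞ y i) where
  ι i := (singleFunctor A i).map biprod.fst ≫ dX.ι i ≫ biprod.inl +
    (singleFunctor A i).map biprod.snd ≫ dY.ι i ≫ biprod.inr
  π i := biprod.fst ≫ dX.π i ≫ (singleFunctor A i).map biprod.inl +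
    biprod.snd ≫ dY.π i ≫ (singleFunctor A i).map biprod.inr
  ι_π i := by
    simp [dX.ι_π_assoc, dY.ι_π_assoc]
    rw [← Functor.map_comp, ← Functor.map_comp, ← Functor.map_add, biprod.total,
      CategoryTheory.Functor.map_id]
  ι_π_ne i j h := by simp [dX.ι_π_ne_assoc i j h, dY.ι_π_ne_assoc i j h]
  supp := dX.supp ∪ dY.supp
  isZero i h := by
    rw [Finset.notMem_union] at h
    exact (biprod_isZero_iff _ _).2 ⟨dX.isZero i h.1, dY.isZero i h.2⟩
  total := by
    have h1 : ∀ i, (biprod.fst ≫ dX.π i ≫ (singleFunctor A i).map biprod.inl +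
        biprod.snd ≫ dY.π i ≫ (singleFunctor A i).map biprod.inr) ≫
        ((singleFunctor A i).map biprod.fst ≫ dX.ι i ≫ biprod.inl +
        (singleFunctor A i).map biprod.snd ≫ dY.ι i ≫ biprod.inr) =
        biprod.fst ≫ (dX.π i ≫ dX.ι i) ≫ biprod.inl +
          biprod.snd ≫ (dY.π i ≫ dY.ι i) ≫ (biprod.inr : Y ⟶ X ⊞ Y) := fun i => by
      simp only [Preadditive.add_comp, Preadditive.comp_add, Category.assoc,
        ← Functor.map_comp_assoc, biprod.inl_fst, biprod.inl_snd, biprod.inr_fst, biprod.inr_snd]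
      simp
    simp only [h1]
    rw [Finset.sum_add_distrib, ← Preadditive.comp_sum, ← Preadditive.sum_comp,
      ← Preadditive.comp_sum, ← Preadditive.sum_comp,
      dX.total_of_subset Finset.subset_union_left, dY.total_of_subset Finset.subset_union_right]
    simp

/-- A bounded complex with zero differential is the direct sum of its components. -/
def ofComplex (K : CochainComplex A ℤ) (hd : ∀ i j, K.d i j = 0) (hK : IsBoundedComplex K) :
    FormalDecomp (Q.obj K) K.X where
  ι i := (singleFunctorIsoCompQ A i).hom.app (K.X i) ≫ Q.map (fromComponent K hd i)
  π i := Q.map (toComponent K hd i) ≫ (singleFunctorIsoCompQ A i).inv.app (K.X i)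
  ι_π i := by
    rw [Category.assoc, ← Q.map_comp_assoc, fromComponent_toComponent]
    simp
  ι_π_ne i j h := by
    rw [Category.assoc, ← Q.map_comp_assoc, fromComponent_toComponent_ne K hd i j h]
    simp
  supp := Set.Finite.toFinset (s := {i | ¬ IsZero (K.X i)}) hK
  isZero i h := by_contra fun hz => h ((Set.Finite.mem_toFinset _).2 hz)
  total := by
    rw [← Q.map_id, ← sum_toComponent_fromComponent K hd
      (Set.Finite.toFinset (s := {i | ¬ IsZero (K.X i)}) hK)
      (fun i h => by_contra fun hz => h ((Set.Finite.mem_toFinset _).2 hz)),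
      Functor.map_sum]
    refine Finset.sum_congr rfl fun i _ => ?_
    rw [Category.assoc, Iso.inv_hom_id_app_assoc, ← Q.map_comp]

theorem nonempty_single (X : A) (i : ℤ) :
    ∃ x : ℤ → A, Nonempty (FormalDecomp ((singleFunctor A i).obj X) x) := by
  let K := (HomologicalComplex.single A (ComplexShape.up ℤ) i).obj X
  have hK : IsBoundedComplex K := by
    refine (Set.finite_singleton i).subset fun j hj => ?_
    by_contra h
    exact hj (HomologicalComplex.isZero_single_obj_X (ComplexShape.up ℤ) i _ j h)
  exact ⟨_, ⟨ofComplex K (fun _ _ => rfl) hK⟩⟩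

end FormalDecomp

end

/-! ### Cohomology and matrices of morphisms -/

section

variable {A : Type u} [Category.{v} A] [Abelian A] [HasDerivedCategory.{w} A]

theorem isZero_homology_single (X : A) (i j : ℤ) (h : i ≠ j) :
    IsZero ((homologyFunctor A j).obj ((singleFunctor A i).obj X)) := by
  rcases lt_or_gt_of_ne h with h | h
  · exact isZero_of_isLE _ i j h
  · exact isZero_of_isGE _ i j h

/-- The cohomology in degree `i` of an object placed in degree `i`. -/
def homologySingleIso (X : A) (i : ℤ) :
    (homologyFunctor A i).obj ((singleFunctor A i).obj X) ≅ X :=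
  (singleFunctorCompHomologyFunctorIso A i).app X

theorem homologySingleIso_naturality {X Y : A} (f : X ⟶ Y) (i : ℤ) :
    (homologyFunctor A i).map ((singleFunctor A i).map f) ≫ (homologySingleIso Y i).hom =
      (homologySingleIso X i).hom ≫ f :=
  (singleFunctorCompHomologyFunctorIso A i).hom.naturality f

theorem homologySingleIso_naturality_assoc {X Y Z : A} (f : X ⟶ Y) (i : ℤ) (h : Y ⟶ Z) :
    (homologyFunctor A i).map ((singleFunctor A i).map f) ≫ (homologySingleIso Y i).hom ≫ h =
      (homologySingleIso X i).hom ≫ f ≫ h := by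
  rw [← Category.assoc, homologySingleIso_naturality, Category.assoc]

namespace FormalDecomp

variable {X Y Z : DerivedCategory A} {x y z : ℤ → A}

/-- The summands of a decomposition are the cohomology objects. -/
def homologyIso (d : FormalDecomp X x) (i : ℤ) : (homologyFunctor A i).obj X ≅ x i where
  hom := (homologyFunctor A i).map (d.π i) ≫ (homologySingleIso (x i) i).hom
  inv := (homologySingleIso (x i) i).inv ≫ (homologyFunctor A i).map (d.ι i)
  hom_inv_id := by
    have h := congrArg (homologyFunctor A i).map
      (d.total_of_subset (s := insert i d.supp) (Finset.subset_insert i d.supp))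
    rw [Functor.map_sum, Finset.sum_eq_single_of_mem i (Finset.mem_insert_self i _)
      (fun j _ hj => by
        rw [Functor.map_comp, (isZero_homology_single (x j) j i hj).eq_of_tgt
          ((homologyFunctor A i).map (d.π j)) 0, zero_comp])] at h
    simpa using h
  inv_hom_id := by
    have h := congrArg (homologyFunctor A i).map (d.ι_π i)
    rw [Functor.map_comp, CategoryTheory.Functor.map_id] at h
    simp [reassoc_of% h]

theorem isZero_of_homology (d : FormalDecomp X x) (i : ℤ)
    (h : IsZero ((homologyFunctor A i).obj X)) : IsZero (x i) :=
  h.of_iso (d.homologyIso i).symm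

/-- Isomorphism classes of decomposable objects are determined by the cohomology. -/
theorem nonempty_iso_iff (dX : FormalDecomp X x) (dY : FormalDecomp Y y) :
    Nonempty (X ≅ Y) ↔ ∀ i, Nonempty (x i ≅ y i) := by
  constructor
  · rintro ⟨e⟩ i
    exact ⟨(dX.homologyIso i).symm ≪≫ (homologyFunctor A i).mapIso e ≪≫ dY.homologyIso i⟩
  · intro h
    exact ⟨(dX.congr (Iso.refl X) fun i => (h i).some).iso dY⟩

/-- The diagonal entry in degree `i` of the matrix of a morphism. -/
def diag (dX : FormalDecomp X x) (dY : FormalDecomp Y y) (f : X ⟶ Y) (i : ℤ) : x i ⟶ y i :=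
  (singleFunctor A i).preimage (dX.ι i ≫ f ≫ dY.π i)

@[simp]
theorem map_diag (dX : FormalDecomp X x) (dY : FormalDecomp Y y) (f : X ⟶ Y) (i : ℤ) :
    (singleFunctor A i).map (dX.diag dY f i) = dX.ι i ≫ f ≫ dY.π i :=
  Functor.map_preimage _ _

/-- The entry of the matrix of a morphism in `Ext¹(x (i + 1), y i)`. -/
def offDiag (dX : FormalDecomp X x) (dY : FormalDecomp Y y) (f : X ⟶ Y) (i : ℤ) :
    (singleFunctor A (i + 1)).obj (x (i + 1)) ⟶ (singleFunctor A i).obj (y i) :=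
  dX.ι (i + 1) ≫ f ≫ dY.π i

theorem homology_map (dX : FormalDecomp X x) (dY : FormalDecomp Y y) (f : X ⟶ Y) (i : ℤ) :
    (homologyFunctor A i).map f ≫ (dY.homologyIso i).hom =
      (dX.homologyIso i).hom ≫ dX.diag dY f i := by
  rw [← cancel_epi (dX.homologyIso i).inv, Iso.inv_hom_id_assoc]
  have h := homologySingleIso_naturality (dX.diag dY f i) i
  rw [map_diag, Functor.map_comp, Functor.map_comp] at h
  change ((homologySingleIso (x i) i).inv ≫ (homologyFunctor A i).map (dX.ι i)) ≫
    (homologyFunctor A i).map f ≫ (homologyFunctor A i).map (dY.π i) ≫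
      (homologySingleIso (y i) i).hom = _
  simp only [Category.assoc] at h ⊢
  rw [h, Iso.inv_hom_id_assoc]

/-- In the hereditary case a morphism is determined by the entries of its matrix in
`Hom(x i, y i)` and in `Ext¹(x (i + 1), y i)`, which are arbitrary. -/
def homEquiv [IsDerivedHereditary A] (dX : FormalDecomp X x) (dY : FormalDecomp Y y) :
    (X ⟶ Y) ≃ (∀ i, x i ⟶ y i) × (∀ i, (singleFunctor A (i + 1)).obj (x (i + 1)) ⟶
      (singleFunctor A i).obj (y i)) :=
  Equiv.ofBijective (fun f => (dX.diag dY f, dX.offDiag dY f)) (by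
    constructor
    · intro f g h
      refine dX.hom_ext dY fun i j => ?_
      by_cases h1 : i = j
      · subst h1
        have h' : dX.diag dY f i = dX.diag dY g i := congrFun (congrArg Prod.fst h) i
        rw [← map_diag, ← map_diag, h']
      · by_cases h2 : i = j + 1
        · subst h2
          exact congrFun (congrArg Prod.snd h) j
        · have := subsingleton_single_hom (x i) (y j) i j h1 h2
          exact Subsingleton.elim _ _
    · rintro ⟨φ, ε⟩
      let f : X ⟶ Y := ∑ j ∈ dY.supp, (dX.π j ≫ (singleFunctor A j).map (φ j) +
        dX.π (j + 1) ≫ ε j) ≫ dY.ι j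
      have hf : ∀ j, f ≫ dY.π j = dX.π j ≫ (singleFunctor A j).map (φ j) +
          dX.π (j + 1) ≫ ε j := fun j => by
        simp only [f, Preadditive.sum_comp, Category.assoc]
        by_cases hj : j ∈ dY.supp
        · rw [Finset.sum_eq_single_of_mem j hj fun k _ hk => by
            rw [dY.ι_π_ne k j hk, comp_zero], dY.ι_π, Category.comp_id]
        · exact ((singleFunctor A j).map_isZero (dY.isZero j hj)).eq_of_tgt _ _
      refine ⟨f, Prod.ext (funext fun i => ?_) (funext fun i => ?_)⟩
      · refine (singleFunctor A i).map_injective ?_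
        rw [map_diag, hf, Preadditive.comp_add, dX.ι_π_assoc,
          dX.ι_π_ne_assoc i (i + 1) (by lia), zero_comp, add_zero]
      · change dX.ι (i + 1) ≫ f ≫ dY.π i = ε i
        rw [hf, Preadditive.comp_add, dX.ι_π_assoc,
          dX.ι_π_ne_assoc (i + 1) i (by lia), zero_comp, zero_add])

end FormalDecomp

/-! ### Formality -/

/-- Formality by induction on the number of degrees in which there is cohomology: the truncation
triangle that separates the highest degree splits, because its connecting morphism lies in a sum of
groups `Extⁿ` with `n ≥ 2`. -/
theorem exists_formalDecomp_of_isGE_of_isLE [IsDerivedHereditary A] (n : ℕ) (a : ℤ)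
    (X : DerivedCategory A) [X.IsGE a] [X.IsLE (a + n - 1)] :
    ∃ x, Nonempty (FormalDecomp X x) := by
  induction n generalizing X with
  | zero =>
    have hX : IsZero X := TStructure.t.isZero X (a + (0 : ℕ) - 1) a (by lia)
    exact ⟨fun _ => 0, ⟨{
      ι := fun _ => 0
      π := fun _ => 0
      ι_π := fun i => ((singleFunctor A i).map_isZero (isZero_zero A)).eq_of_tgt _ _
      ι_π_ne := fun _ _ _ => comp_zero
      supp := ∅
      isZero := fun _ _ => isZero_zero A
      total := hX.eq_of_tgt _ _ }⟩⟩
  | succ n ih =>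
    obtain ⟨U, V, hU, hV, f, g, h, hT⟩ := TStructure.t.exists_triangle X (a + n - 1) (a + n)
      (by lia)
    have hU : U.IsLE (a + n - 1) := ⟨hU⟩
    have hV : V.IsGE (a + n) := ⟨hV⟩
    have hU' : U.IsGE a := (isGE_iff _ _).2 fun i hi => by
      refine (HomologySequence.exact₁ _ hT (i - 1) i).isZero_of_both_zeros ?_ ?_
      · exact (isZero_of_isGE V (a + n) (i - 1) (by lia)).eq_of_src _ _
      · exact (isZero_of_isGE X a i hi).eq_of_tgt _ _
    have hV' : V.IsLE (a + n) := (isLE_iff _ _).2 fun i hi => by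
      refine (HomologySequence.exact₃ _ hT i (i + 1)).isZero_of_both_zeros ?_ ?_
      · exact (isZero_of_isLE X (a + (n + 1 : ℕ) - 1) i (by lia)).eq_of_src _ _
      · exact (isZero_of_isLE U (a + n - 1) (i + 1) (by lia)).eq_of_tgt _ _
    obtain ⟨u, ⟨dU⟩⟩ := ih U
    obtain ⟨V', ⟨e⟩⟩ := exists_iso_singleFunctor_obj_of_isGE_of_isLE V (a + n)
    have hh : h = 0 := by
      rw [← cancel_epi e.inv]
      refine dU.to_shift_ext fun j => ?_
      by_cases hj : j + 1 ≤ a + n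
      · exact (subsingleton_single_hom_shift V' (u j) (a + n) j hj).elim _ _
      · have h0 := dU.isZero_of_homology j (isZero_of_isLE U (a + n - 1) j (by lia))
        exact ((shiftFunctor (DerivedCategory A) (1 : ℤ)).map_isZero
          ((singleFunctor A j).map_isZero h0)).eq_of_tgt _ _
    obtain ⟨e', -, -⟩ := exists_iso_binaryBiproduct_of_distTriang _ hT hh
    obtain ⟨v, ⟨dV⟩⟩ := FormalDecomp.nonempty_single V' (a + n)
    exact ⟨_, ⟨(dU.biprod (dV.congr e.symm fun _ => Iso.refl _)).congr e'.symm
      fun _ => Iso.refl _⟩⟩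

/-- Formality: over a hereditary category every bounded object of the derived category is the
direct sum of its cohomology objects. -/
theorem exists_formalDecomp [IsDerivedHereditary A] (X : DerivedCategory A)
    (hX : TStructure.t.bounded X) : ∃ x, Nonempty (FormalDecomp X x) := by
  obtain ⟨⟨a, ha⟩, ⟨b, hb⟩⟩ := hX
  have : X.IsLE (a + (b - a + 1).toNat - 1) := TStructure.t.isLE_of_le X b _ (by lia)
  exact exists_formalDecomp_of_isGE_of_isLE (b - a + 1).toNat a X

end

/-! ### The cohomology of a cone -/

section

section

variable {A : Type u} [Category.{v} A] [Abelian A]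

/-- A form of the five lemma: in a ladder with exact rows `Y' ⟶ W' ⟶ X' ⟶ 0` and
`Y ⟶ C ⟶ X₁ ⟶ Y₁`, whose vertical maps are an epimorphism on the left and the inclusion of the
kernel of `X₁ ⟶ Y₁` on the right, the middle vertical map is an epimorphism with the kernel coming
from the left column. -/
theorem epi_and_exact_of_ladder {K Y' W' X' Y C X₁ Y₁ : A} {u : K ⟶ Y'} {g' : Y' ⟶ W'}
    {δ' : W' ⟶ X'} {g : Y ⟶ C} {δ : C ⟶ X₁} {f₁ : X₁ ⟶ Y₁} {b : Y' ⟶ Y} {c : W' ⟶ C}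
    {a : X' ⟶ X₁} (w' : g' ≫ δ' = 0) (hw' : (ShortComplex.mk g' δ' w').Exact) [Epi δ']
    (w : g ≫ δ = 0) (hw : (ShortComplex.mk g δ w).Exact) (w₁ : δ ≫ f₁ = 0)
    (wa : a ≫ f₁ = 0) (hwa : (ShortComplex.mk a f₁ wa).Exact) [Mono a] [Epi b]
    (hb : b ≫ g = g' ≫ c) (hc : c ≫ δ = δ' ≫ a)
    (wu : u ≫ b ≫ g = 0) (hwu : (ShortComplex.mk u (b ≫ g) wu).Exact) :
    Epi c ∧ ∃ wc : (u ≫ g') ≫ c = 0, (ShortComplex.mk (u ≫ g') c wc).Exact := by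
  have wc : (u ≫ g') ≫ c = 0 := by rw [Category.assoc, ← hb, wu]
  refine ⟨?_, wc, ?_⟩
  · rw [epi_iff_surjective_up_to_refinements]
    intro G s
    obtain ⟨G₁, p₁, _, t, ht⟩ := hwa.exact_up_to_refinements (s ≫ δ)
      (by rw [Category.assoc, w₁, comp_zero])
    obtain ⟨G₂, p₂, _, r, hr⟩ := surjective_up_to_refinements_of_epi δ' t
    obtain ⟨G₃, p₃, _, y, hy⟩ := hw.exact_up_to_refinements (p₂ ≫ p₁ ≫ s - r ≫ c) (by
      dsimp at ht ⊢
      rw [Preadditive.sub_comp, Category.assoc, Category.assoc, ht, Category.assoc, hc,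
        reassoc_of% hr, sub_self])
    obtain ⟨G₄, p₄, _, z, hz⟩ := surjective_up_to_refinements_of_epi b y
    dsimp at hy
    refine ⟨G₄, p₄ ≫ p₃ ≫ p₂ ≫ p₁, inferInstance, p₄ ≫ p₃ ≫ r + z ≫ g', ?_⟩
    rw [Preadditive.add_comp, Category.assoc z, ← hb, ← reassoc_of% hz, ← hy]
    simp
  · rw [ShortComplex.exact_iff_exact_up_to_refinements]
    intro G s hs
    dsimp at s hs
    obtain ⟨G₁, p₁, _, y, hy⟩ := hw'.exact_up_to_refinements s (by
      dsimp
      rw [← cancel_mono a, Category.assoc, ← hc, reassoc_of% hs, zero_comp, zero_comp])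
    dsimp at y hy
    have hyz : y ≫ b ≫ g = 0 := by rw [hb, ← reassoc_of% hy, hs, comp_zero]
    obtain ⟨G₂, p₂, _, z, hz⟩ := hwu.exact_up_to_refinements y hyz
    dsimp at z hz
    exact ⟨G₂, p₂ ≫ p₁, inferInstance, z, by
      dsimp
      rw [Category.assoc, hy, reassoc_of% hz]⟩

/-- Two quotients of the same object by the same subobject are isomorphic. -/
theorem nonempty_iso_of_exact {K W C C' : A} {t : K ⟶ W} {c : W ⟶ C} {c' : W ⟶ C'}
    (h : Epi c ∧ ∃ w : t ≫ c = 0, (ShortComplex.mk t c w).Exact)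
    (h' : Epi c' ∧ ∃ w : t ≫ c' = 0, (ShortComplex.mk t c' w).Exact) : Nonempty (C ≅ C') := by
  obtain ⟨hc, w, hw⟩ := h
  obtain ⟨hc', w', hw'⟩ := h'
  have : Epi (ShortComplex.mk t c w).g := hc
  have : Epi (ShortComplex.mk t c' w').g := hc'
  exact ⟨hw.gIsCokernel.coconePointUniqueUpToIso hw'.gIsCokernel⟩

theorem exact_transport {X₁ X₂ X₃ Y₁ Y₂ Y₃ : A} {f : X₁ ⟶ X₂} {g : X₂ ⟶ X₃} {f' : Y₁ ⟶ Y₂}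
    {g' : Y₂ ⟶ Y₃} {w : f ≫ g = 0} (h : (ShortComplex.mk f g w).Exact) (e₁ : X₁ ≅ Y₁)
    (e₂ : X₂ ≅ Y₂) (e₃ : X₃ ≅ Y₃) (c₁ : f ≫ e₂.hom = e₁.hom ≫ f')
    (c₂ : g ≫ e₃.hom = e₂.hom ≫ g') : ∃ w' : f' ≫ g' = 0, (ShortComplex.mk f' g' w').Exact := by
  have w' : f' ≫ g' = 0 := by
    rw [← cancel_epi e₁.hom, ← reassoc_of% c₁, ← c₂, reassoc_of% w, zero_comp, comp_zero]
  exact ⟨w', ShortComplex.exact_of_iso (ShortComplex.isoMk e₁ e₂ e₃ c₁.symm c₂.symm) h⟩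

variable [HasDerivedCategory.{w} A]

/-- The ladder lemma applied to the cohomology sequences of a morphism of triangles. -/
theorem epi_and_exact_homology {X' Y' Z' X Y Z : DerivedCategory A} {f' : X' ⟶ Y'} {g' : Y' ⟶ Z'}
    {h' : Z' ⟶ X'⟦(1 : ℤ)⟧} {f : X ⟶ Y} {g : Y ⟶ Z} {h : Z ⟶ X⟦(1 : ℤ)⟧}
    (hT' : Triangle.mk f' g' h' ∈ distTriang _) (hT : Triangle.mk f g h ∈ distTriang _)
    {a : X' ⟶ X} {b : Y' ⟶ Y} (comm : f' ≫ b = a ≫ f) (i : ℤ)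
    (hY' : IsZero ((homologyFunctor A (i + 1)).obj Y'))
    (hb : Epi ((homologyFunctor A i).map b))
    (ha : Mono ((homologyFunctor A (i + 1)).map a))
    (wa : (homologyFunctor A (i + 1)).map a ≫ (homologyFunctor A (i + 1)).map f = 0)
    (hwa : (ShortComplex.mk _ _ wa).Exact)
    {K : A} (u : K ⟶ (homologyFunctor A i).obj Y')
    (wu : u ≫ (homologyFunctor A i).map b ≫ (homologyFunctor A i).map g = 0)
    (hwu : (ShortComplex.mk u _ wu).Exact) :
    ∃ c : Z' ⟶ Z, Epi ((homologyFunctor A i).map c) ∧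
      ∃ wc : (u ≫ (homologyFunctor A i).map g') ≫ (homologyFunctor A i).map c = 0,
        (ShortComplex.mk _ _ wc).Exact := by
  let φ := completeDistinguishedTriangleMorphism _ _ hT' hT a b comm
  let δ' : (homologyFunctor A i).obj Z' ⟶ (homologyFunctor A (i + 1)).obj X' :=
    HomologySequence.δ (Triangle.mk f' g' h') i (i + 1) rfl
  let δ : (homologyFunctor A i).obj Z ⟶ (homologyFunctor A (i + 1)).obj X :=
    HomologySequence.δ (Triangle.mk f g h) i (i + 1) rfl
  let c : Z' ⟶ Z := φ.hom₃
  have h1 : Epi δ' :=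
    (HomologySequence.exact₁ _ hT' i (i + 1) rfl).epi_f (hY'.eq_of_tgt _ _)
  have hc : b ≫ g = g' ≫ c := φ.comm₂.symm
  have e' : (ShortComplex.mk ((homologyFunctor A i).map g') δ'
    (HomologySequence.comp_δ _ hT' i (i + 1) rfl)).Exact :=
    HomologySequence.exact₃ _ hT' i (i + 1) rfl
  have e : (ShortComplex.mk ((homologyFunctor A i).map g) δ
    (HomologySequence.comp_δ _ hT i (i + 1) rfl)).Exact :=
    HomologySequence.exact₃ _ hT i (i + 1) rfl
  exact ⟨c, epi_and_exact_of_ladder _ e' _ e (HomologySequence.δ_comp _ hT i (i + 1) rfl) wa hwa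
    (by rw [← Functor.map_comp, ← Functor.map_comp, hc])
    ((homologyFunctor A 0).homologySequenceδ_naturality _ _ φ i (i + 1) rfl) wu hwu⟩

end

section

variable {A : Type u} [Category.{v} A] [Abelian A] [HasDerivedCategory.{w} A]

/-- The cone of a morphism from an object in degree `i + 1` to an object in degree `i` is
concentrated in degree `i`. -/
theorem exists_iso_single_of_cone {N I : A} {i : ℤ} {W : DerivedCategory A}
    {e : (singleFunctor A (i + 1)).obj N ⟶ (singleFunctor A i).obj I}
    {g : (singleFunctor A i).obj I ⟶ W} {h : W ⟶ ((singleFunctor A (i + 1)).obj N)⟦(1 : ℤ)⟧}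
    (hT : Triangle.mk e g h ∈ distTriang _) :
    ∃ V : A, Nonempty (W ≅ (singleFunctor A i).obj V) := by
  have h0 : ∀ j, i ≠ j → IsZero ((homologyFunctor A j).obj W) := fun j hj => by
    refine (HomologySequence.exact₃ _ hT j (j + 1)).isZero_of_both_zeros ?_ ?_
    · exact (isZero_homology_single I i j hj).eq_of_src _ _
    · exact (isZero_homology_single N (i + 1) (j + 1) (by lia)).eq_of_tgt _ _
  have : W.IsGE i := (isGE_iff _ _).2 fun j hj => h0 j hj.ne'
  have : W.IsLE i := (isLE_iff _ _).2 fun j hj => h0 j hj.ne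
  exact exists_iso_singleFunctor_obj_of_isGE_of_isLE W i


theorem mono_homology_of_cone {N I : A} {i : ℤ} {W : DerivedCategory A}
    {e : (singleFunctor A (i + 1)).obj N ⟶ (singleFunctor A i).obj I}
    {g : (singleFunctor A i).obj I ⟶ W} {h : W ⟶ ((singleFunctor A (i + 1)).obj N)⟦(1 : ℤ)⟧}
    (hT : Triangle.mk e g h ∈ distTriang _) : Mono ((homologyFunctor A i).map g) :=
  (HomologySequence.exact₂ _ hT i).mono_g
    ((isZero_homology_single N (i + 1) i (by lia)).eq_of_src _ _)

namespace FormalDecomp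

variable {X Y C : DerivedCategory A} {x y : ℤ → A} (dX : FormalDecomp X x)
  (dY : FormalDecomp Y y) (f : X ⟶ Y)

/-- The class in `Ext¹(ker fⁱ⁺¹, coker fⁱ)` induced by a morphism `f` between decomposed objects
with diagonal entries `fⁱ`. -/
def inducedClass (i : ℤ) :
    (singleFunctor A (i + 1)).obj (kernel (dX.diag dY f (i + 1))) ⟶
      (singleFunctor A i).obj (cokernel (dX.diag dY f i)) :=
  (singleFunctor A (i + 1)).map (kernel.ι _) ≫ dX.offDiag dY f i ≫
    (singleFunctor A i).map (cokernel.π _)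

/-- The kernel of `Hⁱ(Y) ⟶ Hⁱ(C)` is the image of the diagonal entry of `f`, expressed through the
inclusion of the summand in degree `i`. -/
theorem exact_diag_homology {g : Y ⟶ C} {h : C ⟶ X⟦(1 : ℤ)⟧}
    (hT : Triangle.mk f g h ∈ distTriang _) (i : ℤ) :
    ∃ w : (dX.diag dY f i ≫ (homologySingleIso (y i) i).inv) ≫
        (homologyFunctor A i).map (dY.ι i) ≫ (homologyFunctor A i).map g = 0,
      (ShortComplex.mk _ _ w).Exact := by
  have ex : (ShortComplex.mk ((homologyFunctor A i).map f) ((homologyFunctor A i).map g)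
    (by rw [← Functor.map_comp]
        exact (congrArg _ (comp_distTriang_mor_zero₁₂ _ hT)).trans (Functor.map_zero _ _ _))).Exact :=
    HomologySequence.exact₂ _ hT i
  refine exact_transport ex (dX.homologyIso i)
    (dY.homologyIso i ≪≫ (homologySingleIso (y i) i).symm) (Iso.refl _) ?_ ?_
  · have hf := dX.homology_map dY f i
    dsimp
    rw [reassoc_of% hf]
  · have h1 : (homologySingleIso (y i) i).inv ≫ (homologyFunctor A i).map (dY.ι i) =
      (dY.homologyIso i).inv := rfl
    dsimp
    rw [Category.assoc, reassoc_of% h1, Iso.hom_inv_id_assoc, Category.comp_id]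

/-- The cohomology of the cone of `f` in degree `i` is the middle term of the extension of
`ker fⁱ⁺¹` by `coker fⁱ` with the class induced by `f`. -/
theorem nonempty_homology_cone_iso [IsDerivedHereditary A] {g : Y ⟶ C} {h : C ⟶ X⟦(1 : ℤ)⟧}
    (hT : Triangle.mk f g h ∈ distTriang _) (i : ℤ) {W : DerivedCategory A}
    {g₁ : (singleFunctor A i).obj (cokernel (dX.diag dY f i)) ⟶ W}
    {h₁ : W ⟶ ((singleFunctor A (i + 1)).obj (kernel (dX.diag dY f (i + 1))))⟦(1 : ℤ)⟧}
    (hW : Triangle.mk (dX.inducedClass dY f i) g₁ h₁ ∈ distTriang _) :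
    Nonempty ((homologyFunctor A i).obj C ≅ (homologyFunctor A i).obj W) := by
  let ιN := kernel.ι (dX.diag dY f (i + 1))
  let πI := cokernel.π (dX.diag dY f i)
  -- Both cones receive a map from the cone `W'` of the pullback `e'` of the `Ext¹`-part to the
  -- kernel, and on `Hⁱ` both maps are quotients by the image of `fⁱ`.
  let e' := (singleFunctor A (i + 1)).map ιN ≫ dX.offDiag dY f i
  obtain ⟨W', g', h', hT'⟩ := distinguished_cocone_triangle e'
  let u := dX.diag dY f i ≫ (homologySingleIso (y i) i).inv
  have hY' : IsZero ((homologyFunctor A (i + 1)).obj ((singleFunctor A i).obj (y i))) :=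
    isZero_homology_single (y i) i (i + 1) (by lia)
  have comm₁ : e' ≫ dY.ι i = ((singleFunctor A (i + 1)).map ιN ≫ dX.ι (i + 1)) ≫ f := by
    refine dY.to_ext fun j => ?_
    by_cases h1 : j = i
    · subst h1
      simp [e', offDiag, dY.ι_π]
    · by_cases h2 : j = i + 1
      · subst h2
        have h3 := congrArg (singleFunctor A (i + 1)).map
          (kernel.condition (dX.diag dY f (i + 1)))
        rw [Functor.map_comp, map_diag, Functor.map_zero] at h3
        rw [Category.assoc, dY.ι_π_ne i (i + 1) (by lia), comp_zero, Category.assoc,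
          Category.assoc, h3]
      · have := subsingleton_single_hom (kernel (dX.diag dY f (i + 1))) (y j) (i + 1) j
          (by lia) (by lia)
        exact Subsingleton.elim _ _
  have comm₂ : e' ≫ (singleFunctor A i).map πI = 𝟙 _ ≫ dX.inducedClass dY f i := by
    rw [Category.id_comp]
    exact Category.assoc _ _ _
  obtain ⟨c₁, k₁⟩ : ∃ c : W' ⟶ C, Epi ((homologyFunctor A i).map c) ∧
      ∃ wc : (u ≫ (homologyFunctor A i).map g') ≫ (homologyFunctor A i).map c = 0,
        (ShortComplex.mk _ _ wc).Exact := by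
    have hb : Epi ((homologyFunctor A i).map (dY.ι i)) := by
      have h1 : (homologyFunctor A i).map (dY.ι i) =
          (homologySingleIso (y i) i).hom ≫ (dY.homologyIso i).inv := by
        rw [← Iso.inv_comp_eq]
        rfl
      rw [h1]
      infer_instance
    have ha' : (homologyFunctor A (i + 1)).map ((singleFunctor A (i + 1)).map ιN ≫ dX.ι (i + 1)) =
        (homologySingleIso _ (i + 1)).hom ≫ ιN ≫ (dX.homologyIso (i + 1)).inv := by
      rw [Functor.map_comp, ← homologySingleIso_naturality_assoc]
      change _ = _ ≫ _ ≫ (homologySingleIso (x (i + 1)) (i + 1)).inv ≫ _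
      rw [Iso.hom_inv_id_assoc]
    have ha : Mono ((homologyFunctor A (i + 1)).map
        ((singleFunctor A (i + 1)).map ιN ≫ dX.ι (i + 1))) := by
      rw [ha']
      infer_instance
    obtain ⟨wa, hwa⟩ := exact_transport
      (f' := (homologyFunctor A (i + 1)).map ((singleFunctor A (i + 1)).map ιN ≫ dX.ι (i + 1)))
      (g' := (homologyFunctor A (i + 1)).map f)
      (ShortComplex.exact_kernel (dX.diag dY f (i + 1))) (homologySingleIso _ (i + 1)).symm
      (dX.homologyIso (i + 1)).symm (dY.homologyIso (i + 1)).symm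
      (by rw [ha']; simp [ιN])
      (by
        have hf := dX.homology_map dY f (i + 1)
        dsimp
        rw [Iso.comp_inv_eq, Category.assoc, hf, Iso.inv_hom_id_assoc])
    obtain ⟨wu, hwu⟩ := dX.exact_diag_homology dY f hT i
    exact epi_and_exact_homology hT' hT comm₁ i hY' hb ha wa hwa u wu hwu
  obtain ⟨c₂, k₂⟩ : ∃ c : W' ⟶ W, Epi ((homologyFunctor A i).map c) ∧
      ∃ wc : (u ≫ (homologyFunctor A i).map g') ≫ (homologyFunctor A i).map c = 0,
        (ShortComplex.mk _ _ wc).Exact := by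
    have hb' : (homologyFunctor A i).map ((singleFunctor A i).map πI) =
        (homologySingleIso _ i).hom ≫ πI ≫ (homologySingleIso _ i).inv := by
      rw [← homologySingleIso_naturality_assoc, Iso.hom_inv_id, Category.comp_id]
    have hb : Epi ((homologyFunctor A i).map ((singleFunctor A i).map πI)) := by
      rw [hb']
      infer_instance
    have hm := mono_homology_of_cone hW
    have hz : IsZero ((homologyFunctor A (i + 1)).obj
        ((singleFunctor A i).obj (cokernel (dX.diag dY f i)))) :=
      isZero_homology_single _ i (i + 1) (by lia)
    have ha : (homologyFunctor A (i + 1)).map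
        (𝟙 ((singleFunctor A (i + 1)).obj (kernel (dX.diag dY f (i + 1))))) = 𝟙 _ :=
      CategoryTheory.Functor.map_id _ _
    obtain ⟨wu, hwu⟩ := exact_transport
      (f' := u) (g' := (homologyFunctor A i).map ((singleFunctor A i).map πI))
      (ShortComplex.exact_cokernel (dX.diag dY f i)) (Iso.refl _)
      (homologySingleIso _ i).symm (homologySingleIso _ i).symm (by simp [u])
      (by rw [hb']; simp [πI])
    refine epi_and_exact_homology hT' hW comm₂ i hY' hb ?_ ?_ ?_ u ?_ ?_
    · rw [ha]
      infer_instance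
    · exact hz.eq_of_tgt _ _
    · refine (ShortComplex.exact_iff_epi _ (hz.eq_of_tgt _ _)).2 ?_
      change Epi ((homologyFunctor A (i + 1)).map (𝟙 _))
      rw [ha]
      infer_instance
    · exact ((Category.assoc _ _ _).symm.trans (congrArg (· ≫ _) wu)).trans zero_comp
    · rw [ShortComplex.exact_iff_exact_up_to_refinements] at hwu ⊢
      intro G s hs
      exact hwu s ((cancel_mono ((homologyFunctor A i).map g₁)).1 ((Category.assoc _ _ _).trans (hs.trans zero_comp.symm)))
  exact nonempty_iso_of_exact k₁ k₂

/-- The induced class in degree `i` is the class of an extension with middle term `E` if and only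
if the cone of `f` has cohomology `E` in degree `i`. -/
theorem inducedClass_mem_homWithCone_iff [IsDerivedHereditary A] {g : Y ⟶ C} {h : C ⟶ X⟦(1 : ℤ)⟧}
    (hT : Triangle.mk f g h ∈ distTriang _) (i : ℤ) (E : A) :
    dX.inducedClass dY f i ∈ homWithCone _ _ ((singleFunctor A i).obj E) ↔
      Nonempty ((homologyFunctor A i).obj C ≅ E) := by
  constructor
  · rintro ⟨g₁, h₁, hW⟩
    obtain ⟨e⟩ := dX.nonempty_homology_cone_iso dY f hT i hW
    exact ⟨e ≪≫ homologySingleIso E i⟩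
  · rintro ⟨e⟩
    obtain ⟨W, g₁, h₁, hW⟩ := distinguished_cocone_triangle (dX.inducedClass dY f i)
    obtain ⟨V, ⟨v⟩⟩ := exists_iso_single_of_cone hW
    obtain ⟨e'⟩ := dX.nonempty_homology_cone_iso dY f hT i hW
    let a : V ≅ E := (homologySingleIso V i).symm ≪≫ (homologyFunctor A i).mapIso v.symm ≪≫
      e'.symm ≪≫ e
    let c : W ≅ (singleFunctor A i).obj E := v ≪≫ (singleFunctor A i).mapIso a
    exact ⟨g₁ ≫ c.hom, c.inv ≫ h₁, (distTriang_mk_iso₃ c).1 hW⟩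

theorem bounded_of_isZero_homology (s : Finset ℤ)
    (hs : ∀ i ∉ s, IsZero ((homologyFunctor A i).obj X)) : TStructure.t.bounded X := by
  obtain ⟨a, ha⟩ := s.finite_toSet.bddBelow
  obtain ⟨b, hb⟩ := s.finite_toSet.bddAbove
  exact ⟨⟨a, (isGE_iff _ _).2 fun i hi => hs i fun h => absurd (ha h) (not_le.2 hi)⟩,
    ⟨b, (isLE_iff _ _).2 fun i hi => hs i fun h => absurd (hb h) (not_le.2 hi)⟩⟩

theorem isZero_homology {i : ℤ} (h : i ∉ dX.supp) : IsZero ((homologyFunctor A i).obj X) :=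
  (dX.isZero i h).of_iso (dX.homologyIso i)

open Classical in
/-- The cone of a morphism between decomposable objects is decomposable. -/
theorem exists_formalDecomp_cone [IsDerivedHereditary A] (dX : FormalDecomp X x)
    (dY : FormalDecomp Y y) {f : X ⟶ Y} {g : Y ⟶ C} {h : C ⟶ X⟦(1 : ℤ)⟧}
    (hT : Triangle.mk f g h ∈ distTriang _) : ∃ c, Nonempty (FormalDecomp C c) := by
  refine exists_formalDecomp C (bounded_of_isZero_homology
    (dY.supp ∪ dX.supp.image (· - 1)) fun i hi => ?_)
  rw [Finset.notMem_union, Finset.mem_image] at hi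
  refine (HomologySequence.exact₃ _ hT i (i + 1) rfl).isZero_of_both_zeros ?_ ?_
  · exact (dY.isZero_homology hi.1).eq_of_src _ _
  · exact (dX.isZero_homology fun h => hi.2 ⟨i + 1, h, by lia⟩).eq_of_tgt _ _

/-- A morphism has cone `Z` if and only if the induced classes have the cohomology objects of `Z`
as middle terms. -/
theorem mem_homWithCone_iff [IsDerivedHereditary A] {Z : DerivedCategory A} {z : ℤ → A}
    (dZ : FormalDecomp Z z) :
    f ∈ homWithCone X Y Z ↔
      ∀ i, dX.inducedClass dY f i ∈ homWithCone _ _ ((singleFunctor A i).obj (z i)) := by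
  constructor
  · rintro ⟨g, h, hT⟩ i
    exact (dX.inducedClass_mem_homWithCone_iff dY f hT i (z i)).2 ⟨dZ.homologyIso i⟩
  · intro H
    obtain ⟨C, g, h, hT⟩ := distinguished_cocone_triangle f
    obtain ⟨c, ⟨dC⟩⟩ := dX.exists_formalDecomp_cone dY hT
    obtain ⟨e⟩ := (dC.nonempty_iso_iff dZ).2 fun i => by
      obtain ⟨e⟩ := (dX.inducedClass_mem_homWithCone_iff dY f hT i (z i)).1 (H i)
      exact ⟨(dC.homologyIso i).symm ≪≫ e⟩
    exact ⟨g ≫ e.hom, e.inv ≫ h, (distTriang_mk_iso₃ e).1 hT⟩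

end FormalDecomp

end

end

/-! ### Counting morphisms between decomposed objects -/

section

section

/-- A product of sets indexed by a possibly infinite type, almost all of which have one element. -/
theorem natCard_pi_eq_prod {ι : Type*} {β : ι → Type*} {f : ι → ℚ} (s : Finset ι)
    (hf : ∀ i, (Nat.card (β i) : ℚ) = f i) (h : ∀ i ∉ s, f i = 1) :
    (Nat.card (∀ i, β i) : ℚ) = ∏ i ∈ s, f i := by
  classical
  have h1 : ∀ i : {i // i ∉ s}, Subsingleton (β i) ∧ Nonempty (β i) := fun i => by
    have h2 : Nat.card (β i) = 1 := by
      have := (hf i).trans (h i i.2)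
      exact_mod_cast this
    have h3 := Nat.card_eq_one_iff_unique.1 h2
    exact ⟨h3.1, h3.2⟩
  have : ∀ i : {i // i ∉ s}, Subsingleton (β i) := fun i => (h1 i).1
  have : ∀ i : {i // i ∉ s}, Nonempty (β i) := fun i => (h1 i).2
  have h4 : Nat.card (∀ i : {i // i ∉ s}, β i) = 1 :=
    Nat.card_eq_one_iff_unique.2 ⟨inferInstance, inferInstance⟩
  rw [Nat.card_congr (Equiv.piEquivPiSubtypeProd (· ∈ s) β), Nat.card_prod, h4, mul_one,
    Nat.card_pi, Nat.cast_prod, ← Finset.prod_coe_sort s f]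
  exact Finset.prod_congr rfl fun i _ => hf i

theorem finite_pi_of_subsingleton {ι : Type*} {β : ι → Type*} [∀ i, Finite (β i)] (s : Finset ι)
    (h : ∀ i ∉ s, Subsingleton (β i)) : Finite (∀ i, β i) := by
  refine Finite.of_injective (fun f (i : s) => f i) fun f g hfg => funext fun i => ?_
  by_cases hi : i ∈ s
  · exact congrFun hfg ⟨i, hi⟩
  · exact (h i hi).elim _ _

theorem natCard_sigma_of_card_eq {α : Type*} {β : α → Type*} [Finite α] [∀ a, Finite (β a)] {c : ℚ}
    (h : ∀ a, (Nat.card (β a) : ℚ) = c) : (Nat.card (Σ a, β a) : ℚ) = Nat.card α * c := by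
  have := Fintype.ofFinite α
  rw [Nat.card_sigma, Nat.cast_sum, Finset.sum_congr rfl fun a _ => h a, Finset.sum_const,
    nsmul_eq_mul, Finset.card_univ, Nat.card_eq_fintype_card]

end

section

variable {A : Type u} [Category.{v} A] [Abelian A]

theorem natCard_hom_of_isZero {C : Type u} [Category.{v} C] [HasZeroMorphisms C] {X Y : C}
    (h : IsZero X ∨ IsZero Y) : Nat.card (X ⟶ Y) = 1 := by
  have : Subsingleton (X ⟶ Y) := by
    rcases h with h | h
    · exact ⟨fun _ _ => h.eq_of_src _ _⟩
    · exact ⟨fun _ _ => h.eq_of_tgt _ _⟩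
  exact Nat.card_eq_one_iff_unique.2 ⟨this, ⟨0⟩⟩

theorem autCard_of_isZero {C : Type u} [Category.{v} C] {X : C} (h : IsZero X) :
    autCard X = 1 := by
  have : Subsingleton (Aut X) := ⟨fun _ _ => Iso.ext (h.eq_of_src _ _)⟩
  have h1 : Nat.card (Aut X) = 1 := Nat.card_eq_one_iff_unique.2 ⟨this, ⟨Iso.refl X⟩⟩
  rw [autCard, h1, Nat.cast_one]

theorem hallNumber_of_isZero {X Y L : A} (hX : IsZero X) (hY : IsZero Y) (hL : IsZero L) :
    hallNumber X Y L = 1 := by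
  have h := card_monos X Y L
  rw [autCard_of_isZero hY, one_mul] at h
  rw [← h]
  have h1 : Nat.card {m : Y ⟶ L // Mono m ∧ Nonempty (cokernel m ≅ X)} = 1 := by
    refine Nat.card_eq_one_iff_unique.2 ⟨⟨fun _ _ => Subtype.ext (hL.eq_of_tgt _ _)⟩, ⟨0, ?_, ?_⟩⟩
    · exact ⟨fun _ _ _ => hY.eq_of_tgt _ _⟩
    · exact ⟨IsZero.iso (have : Epi (0 : Y ⟶ L) := ⟨fun _ _ _ => hL.eq_of_src _ _⟩
        isZero_cokernel_of_epi _) hX⟩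
  rw [h1, Nat.cast_one]

variable [HasDerivedCategory.{w} A]

theorem natCard_single_hom_of_isZero {X Y : A} {i j : ℤ} (h : IsZero X ∨ IsZero Y) :
    Nat.card ((singleFunctor A i).obj X ⟶ (singleFunctor A j).obj Y) = 1 :=
  natCard_hom_of_isZero (h.imp (singleFunctor A i).map_isZero (singleFunctor A j).map_isZero)

theorem natCard_hom_congr {C : Type u} [Category.{v} C] {X X' Y Y' : C} (e : X ≅ X')
    (e' : Y ≅ Y') : Nat.card (X ⟶ Y) = Nat.card (X' ⟶ Y') :=
  Nat.card_congr (e.homCongr e')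

/-- Automorphisms as invertible endomorphisms. -/
def autEquiv {C : Type u} [Category.{v} C] (X : C) : Aut X ≃ {f : X ⟶ X // IsIso f} where
  toFun a := ⟨Iso.hom a, Iso.isIso_hom a⟩
  invFun f := have := f.2; asIso f.1
  left_inv _ := Iso.ext rfl
  right_inv _ := rfl

namespace FormalDecomp

variable {X Y Z : DerivedCategory A} {x y z : ℤ → A}

theorem finite_hom [IsDerivedHereditary A] (dX : FormalDecomp X x) (dY : FormalDecomp Y y) :
    Finite (X ⟶ Y) := by
  have := IsDerivedHereditary.finite_hom (A := A)
  have := finite_pi_of_subsingleton (β := fun i => x i ⟶ y i) dY.supp fun i hi =>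
    ⟨fun _ _ => (dY.isZero i hi).eq_of_tgt _ _⟩
  have := finite_pi_of_subsingleton (β := fun i => (singleFunctor A (i + 1)).obj (x (i + 1)) ⟶
      (singleFunctor A i).obj (y i)) dY.supp fun i hi =>
    ⟨fun _ _ => ((singleFunctor A i).map_isZero (dY.isZero i hi)).eq_of_tgt _ _⟩
  exact Finite.of_equiv _ (dX.homEquiv dY).symm

theorem natCard_hom [IsDerivedHereditary A] (dX : FormalDecomp X x) (dY : FormalDecomp Y y)
    (s : Finset ℤ) (hs : ∀ i ∉ s, IsZero (y i)) :
    (Nat.card (X ⟶ Y) : ℚ) = ∏ i ∈ s, ((Nat.card (x i ⟶ y i) : ℚ) *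
      Nat.card ((singleFunctor A (i + 1)).obj (x (i + 1)) ⟶ (singleFunctor A i).obj (y i))) := by
  rw [Nat.card_congr (dX.homEquiv dY), Nat.card_prod, Nat.cast_mul,
    natCard_pi_eq_prod s (fun _ => rfl), natCard_pi_eq_prod s (fun _ => rfl),
    Finset.prod_mul_distrib]
  · intro i hi
    rw [natCard_single_hom_of_isZero (Or.inr (hs i hi)), Nat.cast_one]
  · intro i hi
    rw [natCard_hom_of_isZero (Or.inr (hs i hi)), Nat.cast_one]

theorem isIso_iff (dX : FormalDecomp X x) (dY : FormalDecomp Y y) (f : X ⟶ Y) :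
    IsIso f ↔ ∀ i, IsIso (dX.diag dY f i) := by
  rw [DerivedCategory.isIso_iff]
  refine forall_congr' fun i => ?_
  have h := dX.homology_map dY f i
  constructor
  · intro _
    rw [← Iso.inv_comp_eq] at h
    rw [← h]
    infer_instance
  · intro _
    rw [← Iso.eq_comp_inv] at h
    rw [h]
    infer_instance

/-- A morphism is invertible if and only if its diagonal entries are. -/
theorem autCard_eq [IsDerivedHereditary A] (dX : FormalDecomp X x) (s : Finset ℤ)
    (hs : ∀ i ∉ s, IsZero (x i)) :
    autCard X = ∏ i ∈ s, (autCard (x i) *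
      Nat.card ((singleFunctor A (i + 1)).obj (x (i + 1)) ⟶ (singleFunctor A i).obj (x i))) := by
  let F : {f : X ⟶ X // IsIso f} ≃ (∀ i, Aut (x i)) × (∀ i, (singleFunctor A (i + 1)).obj
      (x (i + 1)) ⟶ (singleFunctor A i).obj (x i)) :=
    { toFun := fun f => (fun i => have := (dX.isIso_iff dX f.1).1 f.2 i
        asIso (dX.diag dX f.1 i), dX.offDiag dX f.1)
      invFun := fun p => ⟨(dX.homEquiv dX).symm (fun i => Iso.hom (p.1 i), p.2), by
        have h : (dX.diag dX _, dX.offDiag dX _) = _ :=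
          (dX.homEquiv dX).apply_symm_apply (fun i => Iso.hom (p.1 i), p.2)
        rw [dX.isIso_iff dX]
        intro i
        have h' : dX.diag dX _ i = Iso.hom (p.1 i) := congrFun (congrArg Prod.fst h) i
        exact h' ▸ Iso.isIso_hom (p.1 i)⟩
      left_inv := fun f => Subtype.ext ((dX.homEquiv dX).symm_apply_apply f.1)
      right_inv := fun p => by
        have h : (dX.diag dX _, dX.offDiag dX _) = _ :=
          (dX.homEquiv dX).apply_symm_apply (fun i => Iso.hom (p.1 i), p.2)
        have h' : dX.offDiag dX _ = p.2 := congrArg Prod.snd h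
        exact Prod.ext (funext fun i => Iso.ext (congrFun (congrArg Prod.fst h) i)) h' }
  rw [autCard, Nat.card_congr ((autEquiv X).trans F), Nat.card_prod, Nat.cast_mul,
    natCard_pi_eq_prod s (f := fun i => autCard (x i)) (fun _ => rfl),
    natCard_pi_eq_prod s (fun _ => rfl), Finset.prod_mul_distrib]
  · intro i hi
    rw [natCard_single_hom_of_isZero (Or.inr (hs i hi)), Nat.cast_one]
  · exact fun i hi => autCard_of_isZero (hs i hi)

/-- The local factor in degree `i` of the number of morphisms with prescribed kernels, images,
cokernels and cone. -/
def localCount (x y z n m c : ℤ → A) (i : ℤ) : ℚ :=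
  autCard (m i) * hallNumber (m i) (n i) (x i) * hallNumber (c i) (m i) (y i) *
    (autCard (n (i + 1)) * autCard (c i) * hallNumber (n (i + 1)) (c i) (z i) / autCard (z i) *
      Nat.card (n (i + 1) ⟶ c i) *
      Nat.card ((singleFunctor A (i + 1)).obj (x (i + 1)) ⟶ (singleFunctor A i).obj (y i)) /
      Nat.card ((singleFunctor A (i + 1)).obj (n (i + 1)) ⟶ (singleFunctor A i).obj (c i)))

/-- The condition that `φ` has kernel `n`, image `m` and cokernel `c`. -/
def HasType {x y : A} (n m c : A) (φ : x ⟶ y) : Prop :=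
  Nonempty (kernel φ ≅ n) ∧ Nonempty (image φ ≅ m) ∧ Nonempty (cokernel φ ≅ c)

/-- The entries in `Ext¹` that induce an extension with middle term `z`: Riedtmann's formula for the
induced classes, multiplied by the cardinality of the kernel of the surjection of `Ext¹` groups. -/
theorem natCard_ext_fibre [IsDerivedHereditary A] {x y x' y' n c z : A} (φ : x ⟶ y) (φ' : x' ⟶ y')
    (hn : Nonempty (kernel φ ≅ n)) (hc : Nonempty (cokernel φ' ≅ c)) (i : ℤ) :
    (Nat.card {ε : (singleFunctor A (i + 1)).obj x ⟶ (singleFunctor A i).obj y' //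
      (singleFunctor A (i + 1)).map (kernel.ι φ) ≫ ε ≫ (singleFunctor A i).map (cokernel.π φ') ∈
        homWithCone _ _ ((singleFunctor A i).obj z)} : ℚ) =
    autCard n * autCard c * hallNumber n c z / autCard z * Nat.card (n ⟶ c) *
      Nat.card ((singleFunctor A (i + 1)).obj x ⟶ (singleFunctor A i).obj y') /
      Nat.card ((singleFunctor A (i + 1)).obj n ⟶ (singleFunctor A i).obj c) := by
  obtain ⟨e⟩ := hn
  obtain ⟨e'⟩ := hc
  have := IsDerivedHereditary.finite_hom (A := A)
  have h1 := card_ext_preimage (kernel.ι φ) (cokernel.π φ') (i + 1) i rfl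
    (homWithCone _ _ ((singleFunctor A i).obj z))
  have h2 := card_homWithCone_single_eq (I := cokernel φ') (E := z) (N := kernel φ) (j := i) rfl
  rw [natCard_hom_congr ((singleFunctor A (i + 1)).mapIso e) ((singleFunctor A i).mapIso e')] at h1
  rw [autCard_congr e, autCard_congr e', hallNumber_congr e e' (Iso.refl z),
    natCard_hom_congr e e'] at h2
  rw [← h2, eq_div_iff (Nat.cast_ne_zero.2 Nat.card_pos.ne')]
  exact_mod_cast h1

/-- The number of morphisms whose components have prescribed kernels, images and cokernels and
whose cone has prescribed cohomology. -/
theorem natCard_fibre [IsDerivedHereditary A] (dX : FormalDecomp X x) (dY : FormalDecomp Y y)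
    (dZ : FormalDecomp Z z) (n m c : ℤ → A) (s : Finset ℤ)
    (hs : ∀ i ∉ s, IsZero (x i) ∧ IsZero (y i) ∧ IsZero (z i) ∧ IsZero (n i) ∧ IsZero (m i) ∧
      IsZero (c i) ∧ IsZero (n (i + 1))) :
    (Nat.card {f : X ⟶ Y // f ∈ homWithCone X Y Z ∧
      ∀ i, HasType (n i) (m i) (c i) (dX.diag dY f i)} : ℚ) =
      ∏ i ∈ s, localCount x y z n m c i := by
  have := IsDerivedHereditary.finite_hom (A := A)
  let T : ℤ → Type v := fun i => {φ : x i ⟶ y i // HasType (n i) (m i) (c i) φ}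
  let V : (∀ i, T i) → ℤ → Type w := fun φ i =>
    {ε : (singleFunctor A (i + 1)).obj (x (i + 1)) ⟶ (singleFunctor A i).obj (y i) //
      (singleFunctor A (i + 1)).map (kernel.ι (φ (i + 1)).1) ≫ ε ≫
        (singleFunctor A i).map (cokernel.π (φ i).1) ∈
          homWithCone _ _ ((singleFunctor A i).obj (z i))}
  have hT : ∀ i, (Nat.card (T i) : ℚ) =
      autCard (m i) * hallNumber (m i) (n i) (x i) * hallNumber (c i) (m i) (y i) := fun i =>
    card_homs _ _ _ _ _
  have hV : ∀ φ i, (Nat.card (V φ i) : ℚ) =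
      autCard (n (i + 1)) * autCard (c i) * hallNumber (n (i + 1)) (c i) (z i) / autCard (z i) *
      Nat.card (n (i + 1) ⟶ c i) *
      Nat.card ((singleFunctor A (i + 1)).obj (x (i + 1)) ⟶ (singleFunctor A i).obj (y i)) /
      Nat.card ((singleFunctor A (i + 1)).obj (n (i + 1)) ⟶ (singleFunctor A i).obj (c i)) :=
    fun φ i => natCard_ext_fibre _ _ (φ (i + 1)).2.1 (φ i).2.2.2 i
  let F : {f : X ⟶ Y // f ∈ homWithCone X Y Z ∧
      ∀ i, HasType (n i) (m i) (c i) (dX.diag dY f i)} → Σ φ : ∀ i, T i, ∀ i, V φ i :=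
    fun f => ⟨fun i => ⟨dX.diag dY f.1 i, f.2.2 i⟩, fun i => ⟨dX.offDiag dY f.1 i,
      (dX.mem_homWithCone_iff dY f.1 dZ).1 f.2.1 i⟩⟩
  have hF : Function.Bijective F := by
    constructor
    · intro f g hfg
      refine Subtype.ext ((dX.homEquiv dY).injective ?_)
      exact congrArg (fun p : Σ φ : ∀ i, T i, ∀ i, V φ i =>
        ((fun i => (p.1 i).1 : ∀ i, x i ⟶ y i), (fun i => (p.2 i).1 : ∀ i,
          (singleFunctor A (i + 1)).obj (x (i + 1)) ⟶ (singleFunctor A i).obj (y i)))) hfg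
    · rintro ⟨φ, ε⟩
      obtain ⟨f, hf⟩ := (dX.homEquiv dY).surjective (fun i => (φ i).1, fun i => (ε i).1)
      have hφ : dX.diag dY f = fun i => (φ i).1 := congrArg Prod.fst hf
      have hε : dX.offDiag dY f = fun i => (ε i).1 := congrArg Prod.snd hf
      have hT : ∀ i, HasType (n i) (m i) (c i) (dX.diag dY f i) := fun i => by
        rw [hφ]
        exact (φ i).2
      obtain rfl : φ = fun i => ⟨dX.diag dY f i, hT i⟩ :=
        funext fun i => Subtype.ext (congrFun hφ i).symm
      have hc : f ∈ homWithCone X Y Z := (dX.mem_homWithCone_iff dY f dZ).2 fun i => by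
        unfold inducedClass
        rw [hε]
        exact (ε i).2
      exact ⟨⟨f, hc, hT⟩, congrArg (Sigma.mk _)
        (funext fun i => Subtype.ext (congrFun hε i))⟩
  have hfin : Finite (∀ i, T i) := finite_pi_of_subsingleton s fun i hi =>
    ⟨fun _ _ => Subtype.ext ((hs i hi).1.eq_of_src _ _)⟩
  have hfin' : ∀ φ, Finite (∀ i, V φ i) := fun φ => finite_pi_of_subsingleton s fun i hi =>
    ⟨fun _ _ => Subtype.ext (((singleFunctor A i).map_isZero (hs i hi).2.1).eq_of_tgt _ _)⟩
  rw [Nat.card_congr (Equiv.ofBijective F hF), natCard_sigma_of_card_eq fun φ => natCard_pi_eq_prod s (hV φ) fun i hi => ?_,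
    natCard_pi_eq_prod s hT fun i hi => ?_, ← Finset.prod_mul_distrib]
  · rfl
  · obtain ⟨h1, h2, h3, h4, h5, h6, h7⟩ := hs i hi
    rw [autCard_of_isZero h5, hallNumber_of_isZero h5 h4 h1, hallNumber_of_isZero h6 h5 h2]
    norm_num
  · obtain ⟨h1, h2, h3, h4, h5, h6, h7⟩ := hs i hi
    rw [autCard_of_isZero h7, autCard_of_isZero h6, autCard_of_isZero h3,
      hallNumber_of_isZero h7 h6 h3, natCard_hom_of_isZero (Or.inl h7),
      natCard_single_hom_of_isZero (Or.inl h7), natCard_single_hom_of_isZero (Or.inr h2)]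
    norm_num

/-- The decomposition of a shifted object. -/
def shift (d : FormalDecomp X x) (k : ℤ) : FormalDecomp (X⟦k⟧) (fun i => x (i + k)) where
  ι i := ((singleFunctors A).shiftIso k i (i + k) (by lia)).inv.app _ ≫ (d.ι (i + k))⟦k⟧'
  π i := (d.π (i + k))⟦k⟧' ≫ ((singleFunctors A).shiftIso k i (i + k) (by lia)).hom.app _
  ι_π i := by
    rw [Category.assoc, ← Functor.map_comp_assoc, d.ι_π, CategoryTheory.Functor.map_id,
      Category.id_comp, Iso.inv_hom_id_app]
  ι_π_ne i j h := by
    rw [Category.assoc, ← Functor.map_comp_assoc, d.ι_π_ne _ _ (by lia), Functor.map_zero,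
      zero_comp, comp_zero]
  supp := d.supp.map (Equiv.subRight k).toEmbedding
  isZero i h := d.isZero _ fun h' => h (Finset.mem_map.2 ⟨i + k, h', by simp⟩)
  total := by
    rw [Finset.sum_map, ← CategoryTheory.Functor.map_id, ← d.total, Functor.map_sum]
    refine Finset.sum_congr rfl fun i _ => ?_
    have key : ∀ j, j = i → ((d.π j)⟦k⟧' ≫ (d.ι j)⟦k⟧' : X⟦k⟧ ⟶ X⟦k⟧) = (d.π i ≫ d.ι i)⟦k⟧' := by
      rintro _ rfl
      exact (Functor.map_comp _ _ _).symm
    rw [Category.assoc, Iso.hom_inv_id_app_assoc]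
    exact key _ (by simp)

end FormalDecomp

end

end

/-! ### Invariance of derived Hall numbers -/

section

theorem curly_congr {T : Type*} [Category T] [Preadditive T] [HasShift T ℤ] {X Y X' Y' : T}
    (a : X ≅ X') (b : Y ≅ Y') : curly X Y = curly X' Y' := by
  unfold curly
  simp only [natCard_hom_congr ((shiftFunctor T _).mapIso a) b]

theorem curly_map {T D : Type*} [Category T] [Preadditive T] [HasShift T ℤ] [Category D]
    [Preadditive D] [HasShift D ℤ] (F : T ⥤ D) [F.Full] [F.Faithful] [F.CommShift ℤ] (X Y : T) :
    curly (F.obj X) (F.obj Y) = curly X Y := by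
  unfold curly
  have : ∀ i : ℕ, Nat.card ((F.obj X)⟦(i : ℤ)⟧ ⟶ F.obj Y) = Nat.card (X⟦(i : ℤ)⟧ ⟶ Y) := fun i =>
    (natCard_hom_congr ((F.commShiftIso (i : ℤ)).symm.app X) (Iso.refl _)).trans
      (Nat.card_congr (Functor.FullyFaithful.ofFullyFaithful F).homEquiv).symm
  simp only [this]

section

variable {T : Type*} [Category T] [HasZeroObject T] [Preadditive T] [HasShift T ℤ]
  [∀ n : ℤ, (shiftFunctor T n).Additive] [Pretriangulated T]

theorem mem_homWithCone_of_iso {L X Z L' X' Z' : T} (a : L ≅ L') (b : X ≅ X') (c : Z ≅ Z')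
    {f : L ⟶ X} (hf : f ∈ homWithCone L X Z) : a.inv ≫ f ≫ b.hom ∈ homWithCone L' X' Z' := by
  obtain ⟨g, h, hT⟩ := hf
  refine ⟨b.inv ≫ g ≫ c.hom, c.inv ≫ h ≫ a.hom⟦(1 : ℤ)⟧', isomorphic_distinguished _ hT _
    (Triangle.isoMk _ _ a b c ?_ ?_ ?_).symm⟩
  · change f ≫ b.hom = a.hom ≫ a.inv ≫ f ≫ b.hom
    simp
  · change g ≫ c.hom = b.hom ≫ b.inv ≫ g ≫ c.hom
    simp
  · change h ≫ a.hom⟦(1 : ℤ)⟧' = c.hom ≫ c.inv ≫ h ≫ a.hom⟦(1 : ℤ)⟧'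
    simp

theorem natCard_homWithCone_congr {L X Z L' X' Z' : T} (a : L ≅ L') (b : X ≅ X') (c : Z ≅ Z') :
    Nat.card (homWithCone L X Z) = Nat.card (homWithCone L' X' Z') := by
  refine Nat.card_congr ((a.homCongr b).subtypeEquiv fun f =>
    ⟨mem_homWithCone_of_iso a b c, fun hf => ?_⟩)
  have := mem_homWithCone_of_iso a.symm b.symm c.symm hf
  simpa using this

theorem derivedHallNumber_congr {X Y L X' Y' L' : T} (a : X ≅ X') (b : Y ≅ Y') (c : L ≅ L') :
    derivedHallNumber X Y L = derivedHallNumber X' Y' L' := by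
  unfold derivedHallNumber
  rw [natCard_homWithCone_congr c a ((shiftFunctor T (1 : ℤ)).mapIso b), autCard_congr a,
    curly_congr c a, curly_congr a a]

variable {D : Type*} [Category D] [HasZeroObject D] [Preadditive D] [HasShift D ℤ]
  [∀ n : ℤ, (shiftFunctor D n).Additive] [Pretriangulated D]
  (F : T ⥤ D) [F.Full] [F.Faithful] [F.CommShift ℤ] [F.IsTriangulated]

theorem map_mem_homWithCone_iff {L X Z : T} (f : L ⟶ X) :
    F.map f ∈ homWithCone (F.obj L) (F.obj X) (F.obj Z) ↔ f ∈ homWithCone L X Z := by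
  constructor
  · rintro ⟨g, h, hT⟩
    obtain ⟨g, rfl⟩ := F.map_surjective g
    obtain ⟨h', hh⟩ := F.map_surjective (h ≫ (F.commShiftIso (1 : ℤ)).inv.app L)
    refine ⟨g, h', (F.map_distinguished_iff _).1 ?_⟩
    have : h = F.map h' ≫ (F.commShiftIso (1 : ℤ)).hom.app L := by
      rw [hh, Category.assoc, Iso.inv_hom_id_app]
      exact (Category.comp_id h).symm
    rw [this] at hT
    exact hT
  · rintro ⟨g, h, hT⟩
    exact ⟨F.map g, F.map h ≫ (F.commShiftIso (1 : ℤ)).hom.app L, F.map_distinguished _ hT⟩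

/-- Derived Hall numbers can be computed after a fully faithful triangulated functor. -/
theorem derivedHallNumber_map (X Y L : T) :
    derivedHallNumber (F.obj X) (F.obj Y) (F.obj L) = derivedHallNumber X Y L := by
  have hF := Functor.FullyFaithful.ofFullyFaithful F
  have h1 : Nat.card (homWithCone L X (Y⟦(1 : ℤ)⟧)) =
      Nat.card (homWithCone (F.obj L) (F.obj X) ((F.obj Y)⟦(1 : ℤ)⟧)) := by
    refine Eq.trans ?_
      (natCard_homWithCone_congr (Iso.refl _) (Iso.refl _) ((F.commShiftIso (1 : ℤ)).app Y))
    exact Nat.card_congr (hF.homEquiv.subtypeEquiv fun f => (map_mem_homWithCone_iff F f).symm)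
  have h2 : autCard (F.obj X) = autCard X := by
    have h3 : Nat.card (X ≅ X) = Nat.card (F.obj X ≅ F.obj X) := Nat.card_congr hF.isoEquiv
    exact congrArg Nat.cast h3.symm
  unfold derivedHallNumber
  rw [h1, h2, curly_map, curly_map]

end

end

/-! ### Alternating products and the Euler form -/

section

/-- Shifting the index by one inverts an alternating product, up to a boundary term. -/
theorem prod_shift_zpow_neg_one_pow (e : ℕ → ℚ) (he : ∀ k, e k ≠ 0) {K : ℕ} (hK : 1 ≤ K)
    (h1 : e K = 1) :
    (∏ k ∈ Finset.Ico 1 K, e (k + 1) ^ ((-1 : ℤ) ^ k)) * e 1 *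
      ∏ k ∈ Finset.Ico 1 K, e k ^ ((-1 : ℤ) ^ k) = 1 := by
  have key : ∀ K, 1 ≤ K → (∏ k ∈ Finset.Ico 1 K, e (k + 1) ^ ((-1 : ℤ) ^ k)) * e 1 *
      ∏ k ∈ Finset.Ico 1 K, e k ^ ((-1 : ℤ) ^ k) = e K ^ ((-1 : ℤ) ^ (K + 1)) := by
    intro K hK
    induction K, hK using Nat.le_induction with
    | base => simp
    | succ K hK ih =>
      rw [Finset.prod_Ico_succ_top hK, Finset.prod_Ico_succ_top hK]
      have h2 : e K ^ ((-1 : ℤ) ^ (K + 1)) * e K ^ ((-1 : ℤ) ^ K) = 1 := by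
        rw [← zpow_add₀ (he K), pow_succ]
        simp
      have h3 : (-1 : ℤ) ^ (K + 1 + 1) = (-1) ^ K := by
        rw [pow_succ, pow_succ]
        ring
      rw [h3]
      linear_combination (e K ^ ((-1 : ℤ) ^ K) * e (K + 1) ^ ((-1 : ℤ) ^ K)) * ih +
        e (K + 1) ^ ((-1 : ℤ) ^ K) * h2
  rw [key K hK, h1, one_zpow]

theorem finprod_le_eq_prod_Ico (f : ℕ → ℚ) (m K : ℕ) (hf : ∀ k, K ≤ k → f k = 1) :
    ∏ᶠ (k : ℕ) (_ : m ≤ k), f k = ∏ k ∈ Finset.Ico m K, f k :=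
  finprod_cond_eq_prod_of_cond_iff f fun {k} hk => by
    rw [Finset.mem_Ico]
    exact ⟨fun h => ⟨h, not_le.1 fun h' => hk (hf k h')⟩, fun h => h.1⟩

/-- Reindexing of a product over all degrees. -/
theorem prod_shift {s : Finset ℤ} (f : ℤ → ℚ) (h : ∀ i ∉ s, f i = 1)
    (h' : ∀ i ∉ s, f (i + 1) = 1) : ∏ i ∈ s, f (i + 1) = ∏ i ∈ s, f i := by
  rw [← finprod_eq_prod_of_mulSupport_subset (s := s) f fun i hi =>
      by_contra fun hi' => hi (h i hi'),
    ← finprod_eq_prod_of_mulSupport_subset (s := s) (fun i => f (i + 1)) fun i hi =>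
      by_contra fun hi' => hi (h' i hi')]
  exact finprod_comp_equiv (Equiv.addRight (1 : ℤ))

section

variable {A : Type u} [Category.{v} A] [Abelian A] [HasExt.{w'} A]

theorem euler_of_isZero {X Y : A} (h : IsZero X ∨ IsZero Y) : euler.{w'} X Y = 1 := by
  have h1 : Subsingleton (Abelian.Ext.{w'} X Y 1) := by
    rcases h with h | h
    · have h0 : ∀ a : Abelian.Ext.{w'} X Y 1, a = 0 := fun a => by
        rw [← Abelian.Ext.mk₀_id_comp a, h.eq_of_src (𝟙 X) 0, Abelian.Ext.mk₀_zero,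
          Abelian.Ext.zero_comp]
      exact ⟨fun a b => (h0 a).trans (h0 b).symm⟩
    · have h0 : ∀ a : Abelian.Ext.{w'} X Y 1, a = 0 := fun a => by
        rw [← Abelian.Ext.comp_mk₀_id a, h.eq_of_src (𝟙 Y) 0, Abelian.Ext.mk₀_zero,
          Abelian.Ext.comp_zero]
      exact ⟨fun a b => (h0 a).trans (h0 b).symm⟩
  have h2 : Nat.card (Abelian.Ext.{w'} X Y 1) = 1 := Nat.card_eq_one_iff_unique.2 ⟨h1, ⟨0⟩⟩
  rw [euler, h2, natCard_hom_of_isZero h]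
  norm_num

/-- The factor `χ_k(x, y) = ∏ᵢ ⟨x (i + k), y i⟩`. -/
def eulerShift (s : Finset ℤ) (x y : ℤ → A) (k : ℕ) : ℚ :=
  ∏ i ∈ s, euler.{w'} (x (i + k)) (y i)

/-- The alternating product of the numbers `χ_k(x, y)` over `k ≥ 1`. -/
def altEuler (s : Finset ℤ) (x y : ℤ → A) (K : ℕ) : ℚ :=
  ∏ k ∈ Finset.Ico 1 K, eulerShift.{w'} s x y k ^ ((-1 : ℤ) ^ k)

theorem eulerShift_eq_div (s : Finset ℤ) (x y : ℤ → A) (k : ℕ) :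
    eulerShift.{w'} s x y k = (∏ i ∈ s, (Nat.card (x (i + k) ⟶ y i) : ℚ)) /
      ∏ i ∈ s, (Nat.card (Abelian.Ext.{w'} (x (i + k)) (y i) 1) : ℚ) := by
  rw [← Finset.prod_div_distrib]
  rfl

/-- The factor in degree `i` of the structure constants. -/
def structureFactor (K : ℕ) (a b x I M N : ℤ → A) (i : ℤ) : ℚ :=
  hallNumber (I i) (M i) (a i) * hallNumber (M i) (N i) (x i) *
    hallNumber (N i) (I (i - 1)) (b i) *
    (autCard (N i) * autCard (M i) * autCard (I i) / (autCard (a i) * autCard (b i))) *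
    ((∏ k ∈ Finset.Ico 2 (K + 1), euler.{w'} (b (i + k)) (a i) ^ ((-1 : ℤ) ^ k)) /
      euler.{w'} (N (i + 1)) (M i))

variable [IsFinitaryHereditary.{w'} A]

/-- If a Hall number does not vanish, then the Euler form is additive. -/
theorem euler_eq_mul_of_hallNumber_ne_zero {X Y L : A} (h : hallNumber X Y L ≠ 0) (W : A) :
    euler.{w'} W L = euler.{w'} W Y * euler.{w'} W X ∧
      euler.{w'} L W = euler.{w'} Y W * euler.{w'} X W := by
  have hfin := IsFinitaryHereditary.finite_hom.{w'} (A := A)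
  have h1 : (Nat.card (ShortExactPairs Y L X) : ℚ) ≠ 0 := by
    rw [card_shortExactPairs]
    exact mul_ne_zero (mul_ne_zero (autCard_pos X).ne' (autCard_pos Y).ne') h
  obtain ⟨⟨f, w, hS⟩⟩ := (Nat.card_ne_zero.1 (Nat.cast_ne_zero.1 h1)).1
  exact ⟨euler_additive_right W hS, euler_additive_left hS W⟩

theorem eulerShift_ne_zero (s : Finset ℤ) (x y : ℤ → A) (k : ℕ) :
    eulerShift.{w'} s x y k ≠ 0 :=
  Finset.prod_ne_zero_iff.2 fun _ _ => (euler_pos.{w'} _ _).ne'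

theorem altEuler_ne_zero (s : Finset ℤ) (x y : ℤ → A) (k : ℕ) :
    altEuler.{w'} s x y k ≠ 0 :=
  Finset.prod_ne_zero_iff.2 fun _ _ => zpow_ne_zero _ (eulerShift_ne_zero.{w'} _ _ _ _)

/-- Additivity of the Euler form on `N ⟶ l ⟶ M`, on `M ⟶ a ⟶ I` and on `I[-1] ⟶ b ⟶ N` leaves, on
both sides, the alternating products of `χ_k(N, a)` and of `χ_k(M, a)` for `k ≥ 1` and the same
factors for `k = 1`: the indices of `χ_{k-1}(I, a)` in `χ_k(b, a)` are shifted by one, which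
inverts its alternating product. -/
theorem altEuler_identity (s : Finset ℤ) {K : ℕ} (hK : 1 ≤ K) (a b l I M N : ℤ → A)
    (hN : ∀ i ∈ s, IsZero (N (i + K)))
    (hl : ∀ i, hallNumber (M i) (N i) (l i) ≠ 0)
    (ha : ∀ i, hallNumber (I i) (M i) (a i) ≠ 0)
    (hb : ∀ i, hallNumber (N (i + 1)) (I i) (b (i + 1)) ≠ 0) :
    altEuler.{w'} s l a K * eulerShift.{w'} s N I 1 * eulerShift.{w'} s N M 1 =
      altEuler.{w'} s a a K * ∏ k ∈ Finset.Ico 2 (K + 1),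
        eulerShift.{w'} s b a k ^ ((-1 : ℤ) ^ k) := by
  have e1 : ∀ k, eulerShift.{w'} s l a k = eulerShift.{w'} s N a k * eulerShift.{w'} s M a k :=
    fun k => by
      simp only [eulerShift, ← Finset.prod_mul_distrib]
      exact Finset.prod_congr rfl fun i _ => (euler_eq_mul_of_hallNumber_ne_zero.{w'} (hl _) _).2
  have e2 : ∀ k, eulerShift.{w'} s a a k = eulerShift.{w'} s M a k * eulerShift.{w'} s I a k :=
    fun k => by
      simp only [eulerShift, ← Finset.prod_mul_distrib]
      exact Finset.prod_congr rfl fun i _ => (euler_eq_mul_of_hallNumber_ne_zero.{w'} (ha _) _).2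
  have e3 : ∀ k, eulerShift.{w'} s b a (k + 1) =
      eulerShift.{w'} s I a k * eulerShift.{w'} s N a (k + 1) := fun k => by
    simp only [eulerShift, ← Finset.prod_mul_distrib]
    refine Finset.prod_congr rfl fun i _ => ?_
    have := (euler_eq_mul_of_hallNumber_ne_zero.{w'} (hb (i + k)) (a i)).2
    rw [add_assoc] at this
    exact_mod_cast this
  have e4 : eulerShift.{w'} s N a 1 = eulerShift.{w'} s N M 1 * eulerShift.{w'} s N I 1 := by
    simp only [eulerShift, ← Finset.prod_mul_distrib]
    exact Finset.prod_congr rfl fun i _ => (euler_eq_mul_of_hallNumber_ne_zero.{w'} (ha _) _).1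
  have e5 : eulerShift.{w'} s N a K = 1 :=
    Finset.prod_eq_one fun i hi => euler_of_isZero.{w'} (Or.inl (hN i hi))
  have e6 := prod_shift_zpow_neg_one_pow _ (eulerShift_ne_zero.{w'} s N a) hK e5
  have e7 : ∏ k ∈ Finset.Ico 2 (K + 1), eulerShift.{w'} s b a k ^ ((-1 : ℤ) ^ k) =
      (∏ k ∈ Finset.Ico 1 K, eulerShift.{w'} s I a k ^ ((-1 : ℤ) ^ k))⁻¹ *
        (∏ k ∈ Finset.Ico 1 K, eulerShift.{w'} s N a (k + 1) ^ ((-1 : ℤ) ^ k))⁻¹ := by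
    rw [← Finset.prod_Ico_add' _ 1 K 1, ← mul_inv, ← Finset.prod_mul_distrib,
      ← Finset.prod_inv_distrib]
    refine Finset.prod_congr rfl fun k _ => ?_
    rw [e3, ← mul_zpow, ← zpow_neg]
    congr 1
    rw [pow_succ]
    ring
  have e8 : altEuler.{w'} s l a K = altEuler.{w'} s N a K * altEuler.{w'} s M a K := by
    simp only [altEuler, e1, mul_zpow, Finset.prod_mul_distrib]
  have e9 : altEuler.{w'} s a a K = altEuler.{w'} s M a K * altEuler.{w'} s I a K := by
    conv_lhs => simp only [altEuler]
    simp only [altEuler, e2, mul_zpow, Finset.prod_mul_distrib]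
  have n1 := altEuler_ne_zero.{w'} s I a K
  have n2 : ∏ k ∈ Finset.Ico 1 K, eulerShift.{w'} s N a (k + 1) ^ ((-1 : ℤ) ^ k) ≠ 0 :=
    Finset.prod_ne_zero_iff.2 fun _ _ => zpow_ne_zero _ (eulerShift_ne_zero.{w'} _ _ _ _)
  change _ * _ * altEuler.{w'} s N a K = 1 at e6
  rw [e7, e8, e9]
  change _ = _ * ((altEuler.{w'} s I a K)⁻¹ * _)
  rw [e4] at e6
  field_simp
  linear_combination (altEuler.{w'} s M a K) * e6

end

end

/-! ### The contribution of one triple of families to a structure constant -/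

section

variable {A : Type u} [Category.{v} A] [Abelian A] [HasExt.{w'} A] [IsFinitaryHereditary.{w'} A]

variable [HasDerivedCategory.{w} A]

namespace FormalDecomp

variable {X Y L : DerivedCategory A} {x y a b l : ℤ → A}

/-- The `k`-th factor of `{X, Y}` consists of `Hom(x (i + k), y i)` and `Ext¹(x (i + k + 1), y i)`.
Together with the groups `Ext¹(x (i + 1), y i)` these form complete Euler forms. -/
theorem curly_mul_prod_ext (dX : FormalDecomp X x) (dY : FormalDecomp Y y) {s : Finset ℤ}
    (hs : ∀ i ∉ s, IsZero (y i)) {K : ℕ} (hK : 1 ≤ K)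
    (hx : ∀ k : ℕ, K ≤ k → ∀ i ∈ s, IsZero (x (i + k))) :
    curly X Y * ∏ i ∈ s, (Nat.card (Abelian.Ext.{w'} (x (i + 1)) (y i) 1) : ℚ) =
      altEuler.{w'} s x y K := by
  have := isDerivedHereditary.{w, w'} (A := A)
  let h : ℕ → ℚ := fun k => ∏ i ∈ s, (Nat.card (x (i + k) ⟶ y i) : ℚ)
  let e : ℕ → ℚ := fun k => ∏ i ∈ s, (Nat.card (Abelian.Ext.{w'} (x (i + k)) (y i) 1) : ℚ)
  have he : ∀ k, e k ≠ 0 := fun k =>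
    Finset.prod_ne_zero_iff.2 fun _ _ => Nat.cast_ne_zero.2 (natCard_ext_one_pos.{w'} _ _).ne'
  have hh1 : ∀ k, K ≤ k → h k = 1 := fun k hk => Finset.prod_eq_one fun i hi => by
    rw [natCard_hom_of_isZero (Or.inl (hx k hk i hi)), Nat.cast_one]
  have he1 : ∀ k, K ≤ k → e k = 1 := fun k hk => Finset.prod_eq_one fun i hi => by
    rw [← natCard_single_hom_succ.{w, w'} _ _ 1 0 (by lia),
      natCard_single_hom_of_isZero (Or.inl (hx k hk i hi)), Nat.cast_one]
  have hom : ∀ k : ℕ, (Nat.card (X⟦(k : ℤ)⟧ ⟶ Y) : ℚ) = h k * e (k + 1) := fun k => by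
    rw [(dX.shift (k : ℤ)).natCard_hom dY s hs, Finset.prod_mul_distrib]
    congr 1
    refine Finset.prod_congr rfl fun i _ => ?_
    rw [natCard_single_hom_succ.{w, w'} _ _ _ _ rfl]
    have h0 : i + 1 + (k : ℤ) = i + ((k + 1 : ℕ) : ℤ) := by
      push_cast
      ring
    rw [h0]
  have h1 : curly X Y = ∏ k ∈ Finset.Ico 1 K, (h k * e (k + 1)) ^ ((-1 : ℤ) ^ k) := by
    unfold curly
    simp only [hom]
    refine finprod_le_eq_prod_Ico (fun k => (h k * e (k + 1)) ^ ((-1 : ℤ) ^ k)) 1 K fun k hk => ?_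
    rw [hh1 k hk, he1 (k + 1) (by lia), one_mul, one_zpow]
  have h2 := prod_shift_zpow_neg_one_pow e he hK (he1 K le_rfl)
  have h3 : altEuler.{w'} s x y K = (∏ k ∈ Finset.Ico 1 K, h k ^ ((-1 : ℤ) ^ k)) /
      ∏ k ∈ Finset.Ico 1 K, e k ^ ((-1 : ℤ) ^ k) := by
    unfold altEuler
    simp only [eulerShift_eq_div, div_zpow, Finset.prod_div_distrib]
    rfl
  have h4 : ∏ k ∈ Finset.Ico 1 K, e k ^ ((-1 : ℤ) ^ k) ≠ 0 :=
    Finset.prod_ne_zero_iff.2 fun _ _ => zpow_ne_zero _ (he _)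
  have h5 : ∏ i ∈ s, (Nat.card (Abelian.Ext.{w'} (x (i + 1)) (y i) 1) : ℚ) = e 1 := by
    simp [e]
  rw [h5, h1, h3, eq_div_iff h4]
  simp only [mul_zpow, Finset.prod_mul_distrib]
  linear_combination (∏ k ∈ Finset.Ico 1 K, h k ^ ((-1 : ℤ) ^ k)) * h2

/-- The contribution of the morphisms of a given type to the structure constant. -/
theorem prod_localCount_mul_eq (dL : FormalDecomp L l) (dX : FormalDecomp X a)
    (I M N : ℤ → A) {s : Finset ℤ}
    (hs : ∀ i ∉ s, IsZero (l i) ∧ IsZero (a i) ∧ IsZero (b i) ∧ IsZero (N i) ∧ IsZero (M i) ∧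
      IsZero (I i) ∧ IsZero (N (i + 1)) ∧ IsZero (b (i + 1)) ∧ IsZero (I (i - 1)))
    {K : ℕ} (hK : 1 ≤ K) (hk : ∀ k : ℕ, K ≤ k → ∀ i ∈ s, IsZero (l (i + k)) ∧
      IsZero (a (i + k)) ∧ IsZero (b (i + k)) ∧ IsZero (N (i + k))) :
    (∏ i ∈ s, localCount l a (fun i => b (i + 1)) N M I i) / autCard X *
      (curly L X / curly X X) = ∏ i ∈ s, structureFactor.{w'} K a b l I M N i := by
  have := isDerivedHereditary.{w, w'} (A := A)
  have hfin := IsFinitaryHereditary.finite_hom.{w'} (A := A)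
  have sgb : ∏ i ∈ s, hallNumber (N (i + 1)) (I i) (b (i + 1)) =
      ∏ i ∈ s, hallNumber (N i) (I (i - 1)) (b i) := by
    refine Eq.trans (Finset.prod_congr rfl fun i _ => ?_)
      (prod_shift (fun i => hallNumber (N i) (I (i - 1)) (b i)) (fun i hi => ?_) fun i hi => ?_)
    · rw [add_sub_cancel_right]
    · obtain ⟨h1, h2, h3, h4, h5, h6, h7, h8, h9⟩ := hs i hi
      exact hallNumber_of_isZero h4 h9 h3
    · obtain ⟨h1, h2, h3, h4, h5, h6, h7, h8, h9⟩ := hs i hi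
      rw [add_sub_cancel_right]
      exact hallNumber_of_isZero h7 h6 h8
  have sN : ∏ i ∈ s, autCard (N (i + 1)) = ∏ i ∈ s, autCard (N i) :=
    prod_shift (fun i => autCard (N i)) (fun i hi => autCard_of_isZero (hs i hi).2.2.2.1)
      fun i hi => autCard_of_isZero (hs i hi).2.2.2.2.2.2.1
  have sb : ∏ i ∈ s, autCard (b (i + 1)) = ∏ i ∈ s, autCard (b i) :=
    prod_shift (fun i => autCard (b i)) (fun i hi => autCard_of_isZero (hs i hi).2.2.1)
      fun i hi => autCard_of_isZero (hs i hi).2.2.2.2.2.2.2.1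
  have hAut := dX.autCard_eq s fun i hi => (hs i hi).2.1
  have hL := dL.curly_mul_prod_ext.{w, w'} dX (fun i hi => (hs i hi).2.1) hK
    fun k h i hi => (hk k h i hi).1
  have hX := dX.curly_mul_prod_ext.{w, w'} dX (fun i hi => (hs i hi).2.1) hK
    fun k h i hi => (hk k h i hi).2.1
  simp only [natCard_single_hom_succ.{w, w'} _ _ _ _ rfl, Finset.prod_mul_distrib] at hAut
  simp only [localCount, structureFactor, natCard_single_hom_succ.{w, w'} _ _ _ _ rfl,
    Finset.prod_mul_distrib, Finset.prod_div_distrib, sgb, sN, sb, hAut]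
  by_cases hz : (∀ i ∈ s, hallNumber (M i) (N i) (l i) ≠ 0) ∧
      (∀ i ∈ s, hallNumber (I i) (M i) (a i) ≠ 0) ∧
      (∀ i ∈ s, hallNumber (N i) (I (i - 1)) (b i) ≠ 0)
  · obtain ⟨zl, za, zb⟩ := hz
    have id := altEuler_identity.{w'} s hK a b l I M N (fun i hi => (hk K le_rfl i hi).2.2.2)
      (fun i => by
        by_cases hi : i ∈ s
        · exact zl i hi
        · obtain ⟨h1, h2, h3, h4, h5, h6, h7, h8, h9⟩ := hs i hi
          rw [hallNumber_of_isZero h5 h4 h1]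
          exact one_ne_zero)
      (fun i => by
        by_cases hi : i ∈ s
        · exact za i hi
        · obtain ⟨h1, h2, h3, h4, h5, h6, h7, h8, h9⟩ := hs i hi
          rw [hallNumber_of_isZero h6 h5 h2]
          exact one_ne_zero)
      (fun i => by
        by_cases hi : i ∈ s
        · by_cases hi' : i + 1 ∈ s
          · have := zb (i + 1) hi'
            rwa [add_sub_cancel_right] at this
          · obtain ⟨h1, h2, h3, h4, h5, h6, h7, h8, h9⟩ := hs (i + 1) hi'
            rw [add_sub_cancel_right] at h9
            rw [hallNumber_of_isZero h4 h9 h3]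
            exact one_ne_zero
        · obtain ⟨h1, h2, h3, h4, h5, h6, h7, h8, h9⟩ := hs i hi
          rw [hallNumber_of_isZero h7 h6 h8]
          exact one_ne_zero)
    have hQ : ∏ i ∈ s, ∏ k ∈ Finset.Ico 2 (K + 1), euler.{w'} (b (i + k)) (a i) ^ ((-1 : ℤ) ^ k) =
        ∏ k ∈ Finset.Ico 2 (K + 1), eulerShift.{w'} s b a k ^ ((-1 : ℤ) ^ k) := by
      rw [Finset.prod_comm]
      exact Finset.prod_congr rfl fun k _ => Finset.prod_zpow _ _ _
    have hNM : ∏ i ∈ s, euler.{w'} (N (i + 1)) (M i) = eulerShift.{w'} s N M 1 := by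
      simp [eulerShift]
    have hNI := eulerShift_eq_div.{w'} s N I 1
    have nNI := eulerShift_ne_zero.{w'} s N I 1
    have nNM := eulerShift_ne_zero.{w'} s N M 1
    have na := altEuler_ne_zero.{w'} s a a K
    have nE : ∀ x y : ℤ → A,
        ∏ i ∈ s, (Nat.card (Abelian.Ext.{w'} (x (i + 1)) (y i) 1) : ℚ) ≠ 0 := fun x y =>
      Finset.prod_ne_zero_iff.2 fun _ _ => Nat.cast_ne_zero.2 (natCard_ext_one_pos.{w'} _ _).ne'
    have nl := nE l a
    have naa := nE a a
    have nNI' := nE N I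
    have nA : ∀ x : ℤ → A, ∏ i ∈ s, autCard (x i) ≠ 0 := fun x =>
      Finset.prod_ne_zero_iff.2 fun _ _ => (autCard_pos _).ne'
    have nAa := nA a
    have nAb := nA b
    rw [hQ, hNM, eq_div_of_mul_eq nl hL, eq_div_of_mul_eq naa hX]
    simp only [Nat.cast_one] at hNI
    rw [eq_div_iff nNI'] at hNI
    rw [← hNI]
    have id' : altEuler.{w'} s l a K / altEuler.{w'} s a a K * eulerShift.{w'} s N I 1 =
        (∏ k ∈ Finset.Ico 2 (K + 1), eulerShift.{w'} s b a k ^ ((-1 : ℤ) ^ k)) /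
          eulerShift.{w'} s N M 1 := by
      rw [div_mul_eq_mul_div, div_eq_div_iff na nNM, id]
      ring
    rw [← id']
    generalize altEuler.{w'} s l a K = q₁ at *
    generalize altEuler.{w'} s a a K = q₂ at *
    generalize eulerShift.{w'} s N I 1 = q₃ at *
    field_simp
  · have : (∏ i ∈ s, hallNumber (M i) (N i) (l i)) * (∏ i ∈ s, hallNumber (I i) (M i) (a i)) *
        (∏ i ∈ s, hallNumber (N i) (I (i - 1)) (b i)) = 0 := by
      by_contra h
      simp only [mul_eq_zero, not_or, Finset.prod_eq_zero_iff, not_exists, not_and] at h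
      exact hz ⟨h.1.1, h.1.2, h.2⟩
    rcases mul_eq_zero.1 this with h | h
    · rcases mul_eq_zero.1 h with h | h <;> simp [h]
    · simp [h]

end FormalDecomp

end

/-! ### Isomorphism classes of bounded objects -/

section

section

variable {C : Type u} [Category.{v} C]

theorem IsoClass.mk_eq_mk_iff {X Y : C} :
    IsoClass.mk X = IsoClass.mk Y ↔ Nonempty (X ≅ Y) :=
  ⟨fun h => Quotient.exact h, fun h => Quotient.sound h⟩

theorem IsoClass.mk_rep (x : IsoClass C) : IsoClass.mk x.rep = x := Quotient.out_eq x

theorem IsoClass.mk_eq_iff {X : C} {x : IsoClass C} :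
    IsoClass.mk X = x ↔ Nonempty (X ≅ x.rep) := by
  conv_lhs => rw [← x.mk_rep]
  exact mk_eq_mk_iff

theorem IsoClass.isZero_rep [HasZeroMorphisms C] [HasZeroObject C] {x : IsoClass C} (h : x = 0) :
    IsZero x.rep := by
  obtain ⟨e⟩ := mk_eq_iff.1 h.symm
  exact (isZero_zero C).of_iso e.symm

theorem IsoClass.mk_eq_zero [HasZeroMorphisms C] [HasZeroObject C] {X : C} (h : IsZero X) :
    IsoClass.mk X = 0 :=
  mk_eq_mk_iff.2 ⟨h.iso (isZero_zero C)⟩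

/-- The family of isomorphism classes of a family of objects, almost all of which are zero. -/
def familyClass [HasZeroMorphisms C] [HasZeroObject C] (x : ℤ → C)
    (hx : ∀ᶠ i in Filter.cofinite, IsZero (x i)) : ℤ →₀ IsoClass C :=
  Finsupp.ofSupportFinite (fun i => IsoClass.mk (x i))
    ((Filter.eventually_cofinite.1 hx).subset fun _ hi h => hi (IsoClass.mk_eq_zero h))

theorem familyClass_eq_iff [HasZeroMorphisms C] [HasZeroObject C] {x : ℤ → C}
    {hx : ∀ᶠ i in Filter.cofinite, IsZero (x i)} {X : ℤ →₀ IsoClass C} :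
    familyClass x hx = X ↔ ∀ i, Nonempty (x i ≅ (X i).rep) := by
  rw [DFunLike.ext_iff]
  exact forall_congr' fun i => IsoClass.mk_eq_iff

theorem eventually_isZero_rep [HasZeroMorphisms C] [HasZeroObject C] (X : ℤ →₀ IsoClass C) :
    ∀ᶠ i in Filter.cofinite, IsZero (X i).rep :=
  Filter.eventually_cofinite.2 (X.hasFiniteSupport.subset fun _ hi h =>
    hi (IsoClass.isZero_rep h))

end

variable {A : Type u} [Category.{v} A] [Abelian A] [HasDerivedCategory.{w} A]

theorem FormalDecomp.eventually_isZero {X : DerivedCategory A} {x : ℤ → A}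
    (d : FormalDecomp X x) : ∀ᶠ i in Filter.cofinite, IsZero (x i) :=
  Filter.eventually_cofinite.2 (d.supp.finite_toSet.subset fun i hi =>
    by_contra fun h => hi (d.isZero i h))

/-- The decomposition of the complex with zero differential given by a family of isomorphism
classes. -/
def zeroDiffDecomp (X : ℤ →₀ IsoClass A) :
    FormalDecomp (Q.obj (zeroDiffComplex X)) (fun i => (X i).rep) :=
  FormalDecomp.ofComplex (zeroDiffComplex X) (fun _ _ => rfl) (zeroDiffComplex_isBounded X)

theorem nonempty_bounded_iso_iff {X Y : DerivedCategory.Bounded A} :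
    Nonempty (X ≅ Y) ↔ Nonempty (X.obj ≅ Y.obj) :=
  ⟨fun ⟨e⟩ => ⟨(Bounded.ι (C := A)).mapIso e⟩, fun ⟨e⟩ => ⟨(Bounded.ι (C := A)).preimageIso e⟩⟩

/-- By formality, the isomorphism classes of the bounded derived category of a hereditary category
are those of the complexes with zero differential. -/
def isoClassEquiv [IsDerivedHereditary A] :
    (ℤ →₀ IsoClass A) ≃ IsoClass (DerivedCategory.Bounded A) :=
  Equiv.ofBijective
    (fun X => IsoClass.mk (toBounded (zeroDiffComplex X) (zeroDiffComplex_isBounded X))) (by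
      constructor
      · intro X Y h
        have h1 := ((zeroDiffDecomp X).nonempty_iso_iff (zeroDiffDecomp Y)).1
          (nonempty_bounded_iso_iff.1 (IsoClass.mk_eq_mk_iff.1 h))
        ext i
        rw [← (X i).mk_rep]
        exact IsoClass.mk_eq_iff.2 (h1 i)
      · intro c
        obtain ⟨x, ⟨d⟩⟩ := exists_formalDecomp c.rep.obj c.rep.property
        refine ⟨familyClass x d.eventually_isZero, IsoClass.mk_eq_iff.2
          (nonempty_bounded_iso_iff.2 (((zeroDiffDecomp _).nonempty_iso_iff d).2 fun i => ?_))⟩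
        obtain ⟨e⟩ := familyClass_eq_iff.1
          (rfl : familyClass x d.eventually_isZero = familyClass x d.eventually_isZero) i
        exact ⟨e.symm⟩)

/-! ### The structure constants -/

theorem natCard_eq_finsum_fibre {α β : Type*} [Finite α] (τ : α → β) :
    (Nat.card α : ℚ) = ∑ᶠ b, (Nat.card {a // τ a = b} : ℚ) := by
  classical
  have := Fintype.ofFinite α
  rw [finsum_eq_sum_of_support_subset (s := Finset.univ.image τ) _ fun b hb => ?_]
  · rw [Nat.card_eq_fintype_card, ← Finset.card_univ,
      Finset.card_eq_sum_card_image τ Finset.univ, Nat.cast_sum]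
    refine Finset.sum_congr rfl fun b _ => ?_
    rw [Nat.card_eq_fintype_card, Fintype.card_subtype]
  · obtain ⟨⟨a, ha⟩⟩ := (Nat.card_ne_zero.1 (Nat.cast_ne_zero.1 hb)).1
    simp [← ha]

theorem exists_bound {P : ℤ → Prop} (hP : ∀ᶠ i in Filter.cofinite, P i) :
    ∃ n : ℕ, ∀ i : ℤ, n < i.natAbs → P i := by
  obtain ⟨n, hn⟩ := ((Filter.eventually_cofinite.1 hP).image Int.natAbs).bddAbove
  refine ⟨n, fun i hi => by_contra fun h => ?_⟩
  have := hn ⟨i, h, rfl⟩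
  exact absurd this (not_le.2 hi)

/-- The factors of the formula as finite products. -/
theorem structureTerm_eq_prod {A : Type u} [Category.{v} A] [Abelian A] [HasExt.{w'} A]
    (A₁ A₂ : CochainComplex A ℤ) (X I M N : ℤ →₀ IsoClass A) {s : Finset ℤ}
    (hs : ∀ i ∉ s, IsZero (X i).rep ∧ IsZero (A₁.X i) ∧ IsZero (A₂.X i) ∧ IsZero (N i).rep ∧
      IsZero (M i).rep ∧ IsZero (I i).rep ∧ IsZero (I (i - 1)).rep)
    {K : ℕ} (hk : ∀ k : ℕ, K ≤ k → ∀ i ∈ s, IsZero (A₂.X (i + k))) :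
    structureTerm.{w'} A₁ A₂ X I M N = ∏ i ∈ s, structureFactor.{w'} K A₁.X A₂.X
      (fun i => (X i).rep) (fun i => (I i).rep) (fun i => (M i).rep) (fun i => (N i).rep) i := by
  have h0 : ∀ (i : ℤ) (k : ℕ), K + 1 ≤ k →
      euler.{w'} (A₂.X (i + k)) (A₁.X i) ^ ((-1 : ℤ) ^ k) = 1 := fun i k hk' => by
    rw [euler_of_isZero.{w'}, one_zpow]
    by_cases hi : i ∈ s
    · exact Or.inl (hk k (by lia) i hi)
    · exact Or.inr (hs i hi).2.1
  have h1 : structureTerm.{w'} A₁ A₂ X I M N = ∏ᶠ i : ℤ, structureFactor.{w'} K A₁.X A₂.X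
      (fun i => (X i).rep) (fun i => (I i).rep) (fun i => (M i).rep) (fun i => (N i).rep) i :=
    finprod_congr fun i => by
      rw [structureFactor, finprod_le_eq_prod_Ico _ 2 (K + 1) (h0 i)]
  rw [h1, finprod_eq_prod_of_mulSupport_subset]
  intro i hi
  by_contra hi'
  obtain ⟨h1, h2, h3, h4, h5, h6, h7⟩ := hs i hi'
  refine hi ?_
  rw [structureFactor, hallNumber_of_isZero h6 h5 h2, hallNumber_of_isZero h5 h4 h1,
    hallNumber_of_isZero h4 h7 h3, autCard_of_isZero h4, autCard_of_isZero h5,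
    autCard_of_isZero h6, autCard_of_isZero h2, autCard_of_isZero h3,
    euler_of_isZero.{w'} (Or.inr h5),
    Finset.prod_eq_one fun k _ => by rw [euler_of_isZero.{w'} (Or.inr h2), one_zpow]]
  norm_num

/-- The classes of the cokernels, images and kernels of the components of a morphism. -/
def typeOf {X L : DerivedCategory A} {l a : ℤ → A} (dL : FormalDecomp L l) (d₁ : FormalDecomp X a) (f : L ⟶ X) :
    (ℤ →₀ IsoClass A) × (ℤ →₀ IsoClass A) × (ℤ →₀ IsoClass A) :=
  (familyClass (fun i => cokernel (dL.diag d₁ f i))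
    (d₁.eventually_isZero.mono fun _ h => h.of_epi (cokernel.π _)),
  familyClass (fun i => image (dL.diag d₁ f i))
    (d₁.eventually_isZero.mono fun _ h => h.of_mono (image.ι _)),
  familyClass (fun i => kernel (dL.diag d₁ f i))
    (dL.eventually_isZero.mono fun _ h => h.of_mono (kernel.ι _)))

theorem typeOf_eq_iff {X L : DerivedCategory A} {l a : ℤ → A}
    (dL : FormalDecomp L l) (d₁ : FormalDecomp X a) (f : L ⟶ X)
    (p : (ℤ →₀ IsoClass A) × (ℤ →₀ IsoClass A) × (ℤ →₀ IsoClass A)) :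
    typeOf dL d₁ f = p ↔ ∀ i, FormalDecomp.HasType (p.2.2 i).rep (p.2.1 i).rep (p.1 i).rep
      (dL.diag d₁ f i) := by
  obtain ⟨I, M, N⟩ := p
  rw [typeOf, Prod.mk.injEq, Prod.mk.injEq, familyClass_eq_iff, familyClass_eq_iff,
    familyClass_eq_iff]
  exact ⟨fun h i => ⟨h.2.2 i, h.2.1 i, h.1 i⟩,
    fun h => ⟨fun i => (h i).2.2, fun i => (h i).2.1, fun i => (h i).1⟩⟩

section

variable [HasExt.{w'} A] [IsFinitaryHereditary.{w'} A]
  {X Y L : DerivedCategory A} {A₁ A₂ : CochainComplex A ℤ}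

/-- Each term of the formula is the normalized number of morphisms `f : L ⟶ A₁` with cone
`A₂⟦1⟧` whose components have the prescribed kernels, images and cokernels. -/
theorem structureTerm_eq (d₁ : FormalDecomp X A₁.X) (d₂ : FormalDecomp Y A₂.X)
    (x I M N : ℤ →₀ IsoClass A) (dL : FormalDecomp L fun i => (x i).rep) :
    structureTerm.{w'} A₁ A₂ x I M N =
      (Nat.card {f : L ⟶ X // f ∈ homWithCone L X (Y⟦(1 : ℤ)⟧) ∧
        ∀ i, FormalDecomp.HasType (N i).rep (M i).rep (I i).rep (dL.diag d₁ f i)} : ℚ) /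
        autCard X * (curly L X / curly X X) := by
  have := isDerivedHereditary.{w, w'} (A := A)
  obtain ⟨n, hn⟩ := exists_bound (dL.eventually_isZero.and (d₁.eventually_isZero.and
    (d₂.eventually_isZero.and ((eventually_isZero_rep N).and ((eventually_isZero_rep M).and
      (eventually_isZero_rep I))))))
  -- The interval is widened by one because of the indices `i + 1` and `i - 1` in the formula.
  have hs : ∀ i ∉ Finset.Icc (-(n : ℤ) - 1) (n + 1), n < i.natAbs ∧ n < (i + 1).natAbs ∧
      n < (i - 1).natAbs := by
    intro i hi
    rw [Finset.mem_Icc] at hi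
    lia
  have hk : ∀ k : ℕ, 2 * n + 3 ≤ k → ∀ i ∈ Finset.Icc (-(n : ℤ) - 1) (n + 1),
      n < (i + k).natAbs := by
    intro k hk i hi
    rw [Finset.mem_Icc] at hi
    lia
  rw [dL.natCard_fibre d₁ (d₂.shift 1) _ _ _ (Finset.Icc (-(n : ℤ) - 1) (n + 1)) fun i hi => ?_,
    dL.prod_localCount_mul_eq.{w, w'} d₁ (b := A₂.X) _ _ _ (fun i hi => ?_)
      (K := 2 * n + 3) (by lia) fun k h i hi => ?_]
  · exact structureTerm_eq_prod.{w'} A₁ A₂ x I M N (fun i hi => by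
      obtain ⟨h1, h2, h3⟩ := hs i hi
      have g1 := hn i h1
      have g3 := hn (i - 1) h3
      exact ⟨g1.1, g1.2.1, g1.2.2.1, g1.2.2.2.1, g1.2.2.2.2.1, g1.2.2.2.2.2, g3.2.2.2.2.2⟩)
      fun k h i hi => (hn _ (hk k h i hi)).2.2.1
  · obtain ⟨h1, h2, h3⟩ := hs i hi
    have g1 := hn i h1
    have g2 := hn (i + 1) h2
    have g3 := hn (i - 1) h3
    exact ⟨g1.1, g1.2.1, g1.2.2.1, g1.2.2.2.1, g1.2.2.2.2.1, g1.2.2.2.2.2, g2.2.2.2.1, g2.2.2.1,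
      g3.2.2.2.2.2⟩
  · have g := hn _ (hk k h i hi)
    exact ⟨g.1, g.2.1, g.2.2.1, g.2.2.2.1⟩
  · obtain ⟨h1, h2, h3⟩ := hs i hi
    have g1 := hn i h1
    have g2 := hn (i + 1) h2
    exact ⟨g1.1, g1.2.1, g2.2.2.1, g1.2.2.2.1, g1.2.2.2.2.1, g1.2.2.2.2.2, g2.2.2.2.1⟩

theorem structureTerm_eq_typeOf (d₁ : FormalDecomp X A₁.X) (d₂ : FormalDecomp Y A₂.X)
    (x : ℤ →₀ IsoClass A) (dL : FormalDecomp L fun i => (x i).rep)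
    (p : (ℤ →₀ IsoClass A) × (ℤ →₀ IsoClass A) × (ℤ →₀ IsoClass A)) :
    structureTerm.{w'} A₁ A₂ x p.1 p.2.1 p.2.2 =
      (Nat.card {f : homWithCone L X (Y⟦(1 : ℤ)⟧) // typeOf dL d₁ f.1 = p} : ℚ) /
        autCard X * (curly L X / curly X X) := by
  rw [structureTerm_eq.{w, w'} d₁ d₂ x _ _ _ dL]
  congr 3
  refine Nat.card_congr (Equiv.trans (Equiv.subtypeEquivRight fun f => ?_)
    (Equiv.subtypeSubtypeEquivSubtypeInter _ fun f => typeOf dL d₁ f = p).symm)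
  rw [typeOf_eq_iff]

theorem finite_support_structureTerm (d₁ : FormalDecomp X A₁.X) (d₂ : FormalDecomp Y A₂.X)
    (x : ℤ →₀ IsoClass A) (dL : FormalDecomp L fun i => (x i).rep) :
    {p : (ℤ →₀ IsoClass A) × (ℤ →₀ IsoClass A) × (ℤ →₀ IsoClass A) |
      structureTerm.{w'} A₁ A₂ x p.1 p.2.1 p.2.2 ≠ 0}.Finite := by
  have := isDerivedHereditary.{w, w'} (A := A)
  have := dL.finite_hom d₁
  refine (Set.finite_range fun f : homWithCone L X (Y⟦(1 : ℤ)⟧) => typeOf dL d₁ f.1).subset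
    fun p hp => ?_
  rw [Set.mem_ofPred_eq, structureTerm_eq_typeOf.{w, w'} d₁ d₂ x dL p] at hp
  have h1 := left_ne_zero_of_mul hp
  rw [div_ne_zero_iff] at h1
  obtain ⟨⟨f, hf⟩⟩ := (Nat.card_ne_zero.1 (Nat.cast_ne_zero.1 h1.1)).1
  exact ⟨f, hf⟩

/-- A structure constant is the sum of the contributions of the types of morphisms. -/
theorem derivedHallNumber_eq_finsum (d₁ : FormalDecomp X A₁.X) (d₂ : FormalDecomp Y A₂.X)
    (x : ℤ →₀ IsoClass A) (dL : FormalDecomp L fun i => (x i).rep) :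
    derivedHallNumber X Y L = ∑ᶠ (I : ℤ →₀ IsoClass A) (M : ℤ →₀ IsoClass A)
      (N : ℤ →₀ IsoClass A), structureTerm.{w'} A₁ A₂ x I M N := by
  have := isDerivedHereditary.{w, w'} (A := A)
  have := dL.finite_hom d₁
  have h := finsum_curry₃ (fun p : (ℤ →₀ IsoClass A) × (ℤ →₀ IsoClass A) × (ℤ →₀ IsoClass A) =>
    structureTerm.{w'} A₁ A₂ x p.1 p.2.1 p.2.2) (finite_support_structureTerm.{w, w'} d₁ d₂ x dL)
  rw [← h]
  simp only [structureTerm_eq_typeOf.{w, w'} d₁ d₂ x dL, div_mul_eq_mul_div, mul_div_assoc]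
  rw [← finsum_mul, ← natCard_eq_finsum_fibre, derivedHallNumber]
  ring

/-- Only finitely many decomposed objects admit a morphism to `X` with cone `Z`. -/
theorem finite_setOf_homWithCone_nonempty {Z : DerivedCategory A} {a z : ℤ → A}
    (dX : FormalDecomp X a) (dZ : FormalDecomp Z z) :
    {x : ℤ →₀ IsoClass A | (homWithCone (Q.obj (zeroDiffComplex x)) X Z).Nonempty}.Finite := by
  have := isDerivedHereditary.{w, w'} (A := A)
  have := dX.finite_hom dZ
  choose f g h hT using fun x : {x : ℤ →₀ IsoClass A |
    (homWithCone (Q.obj (zeroDiffComplex x)) X Z).Nonempty} => x.2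
  -- The object is recovered, up to isomorphism, from the morphism `X ⟶ Z` of its triangle.
  refine Finite.of_injective g fun x y hxy => Subtype.ext (isoClassEquiv.injective ?_)
  refine IsoClass.mk_eq_mk_iff.2 (nonempty_bounded_iso_iff.2 ?_)
  have h1 := rotate_mk.1 (hT x)
  have h2 := rotate_mk.1 (hT y)
  rw [← hxy] at h2
  obtain ⟨e, -, -⟩ := exists_iso_cone_mk h1 h2
  exact ⟨(shiftFunctor (DerivedCategory A) (1 : ℤ)).preimageIso e⟩

end

end

/-! ### The product formula -/

section

theorem basisObj_mul_basisObj {T : Type*} [Category T] [HasZeroObject T] [Preadditive T]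
    [HasShift T ℤ] [∀ n : ℤ, (shiftFunctor T n).Additive] [Pretriangulated T] (X Y : T) :
    basisObj X * basisObj Y =
      ∑ᶠ l : IsoClass T, derivedHallNumber X Y l.rep • basisClass l := by
  obtain ⟨a⟩ := IsoClass.mk_eq_iff.1 (rfl : IsoClass.mk X = IsoClass.mk X)
  obtain ⟨b⟩ := IsoClass.mk_eq_iff.1 (rfl : IsoClass.mk Y = IsoClass.mk Y)
  have h : basisObj X * basisObj Y = basisMul (IsoClass.mk X) (IsoClass.mk Y) := by
    change Finsupp.sum (Finsupp.single (IsoClass.mk X) (1 : ℚ)) (fun x r =>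
      Finsupp.sum (Finsupp.single (IsoClass.mk Y) (1 : ℚ)) fun y s => (r * s) • basisMul x y) = _
    rw [Finsupp.sum_single_index, Finsupp.sum_single_index]
    · rw [one_mul, one_smul]
    · rw [mul_zero, zero_smul]
    · rw [Finsupp.sum_single_index]
      · rw [zero_mul, zero_smul]
      · rw [mul_zero, zero_smul]
  rw [h, basisMul]
  exact finsum_congr fun l => by rw [derivedHallNumber_congr a b (Iso.refl l.rep)]

variable {A : Type u} [Category.{v} A] [Abelian A] [HasDerivedCategory.{w} A]
  {A₁ A₂ : CochainComplex A ℤ}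

theorem derivedHallNumber_toBounded [IsDerivedHereditary A] (hA₁ : IsBoundedComplex A₁)
    (hA₂ : IsBoundedComplex A₂) (x : ℤ →₀ IsoClass A) :
    derivedHallNumber (toBounded A₁ hA₁) (toBounded A₂ hA₂) (isoClassEquiv x).rep =
      derivedHallNumber (Q.obj A₁) (Q.obj A₂) (Q.obj (zeroDiffComplex x)) := by
  obtain ⟨e⟩ := IsoClass.mk_eq_iff.1 (show IsoClass.mk (toBounded (zeroDiffComplex x)
    (zeroDiffComplex_isBounded x)) = isoClassEquiv x from rfl)
  rw [← derivedHallNumber_congr (Iso.refl _) (Iso.refl _) e]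
  exact (derivedHallNumber_map (Bounded.ι (C := A)) _ _ _).symm

end

end DerivedHall

end

theorem proposition5p1 {k : Type*} [Field k] [Finite k]
    {A : Type u} [Category.{v} A] [Abelian A] [Linear k A]
    [HasDerivedCategory.{w} A] [HasExt.{w'} A] [DerivedHall.IsFinitaryHereditary.{w'} A]
    (A₁ A₂ : CochainComplex A ℤ)
    (hA₁ : DerivedHall.IsBoundedComplex A₁) (hA₂ : DerivedHall.IsBoundedComplex A₂)
    (hd₁ : ∀ i j : ℤ, A₁.d i j = 0) (hd₂ : ∀ i j : ℤ, A₂.d i j = 0) :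
    -- the sum defining the product `[A₁][A₂]` in the derived Hall algebra is finite
    {L : DerivedHall.IsoClass (DerivedCategory.Bounded A) |
      DerivedHall.derivedHallNumber (DerivedHall.toBounded A₁ hA₁)
        (DerivedHall.toBounded A₂ hA₂) L.rep ≠ 0}.Finite ∧
    -- the sum over all `X`, `I`, `M`, `N` is finite
    {p : (ℤ →₀ DerivedHall.IsoClass A) × (ℤ →₀ DerivedHall.IsoClass A) ×
        (ℤ →₀ DerivedHall.IsoClass A) × (ℤ →₀ DerivedHall.IsoClass A) |
      DerivedHall.structureTerm.{w'} A₁ A₂ p.1 p.2.1 p.2.2.1 p.2.2.2 ≠ 0}.Finite ∧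
    -- the formula for the product
    DerivedHall.basisObj (DerivedHall.toBounded A₁ hA₁) *
        DerivedHall.basisObj (DerivedHall.toBounded A₂ hA₂) =
      ∑ᶠ X : ℤ →₀ DerivedHall.IsoClass A,
        (∑ᶠ (I : ℤ →₀ DerivedHall.IsoClass A) (M : ℤ →₀ DerivedHall.IsoClass A)
            (N : ℤ →₀ DerivedHall.IsoClass A),
          DerivedHall.structureTerm.{w'} A₁ A₂ X I M N) •
        DerivedHall.basisObj (DerivedHall.toBounded (DerivedHall.zeroDiffComplex X)
          (DerivedHall.zeroDiffComplex_isBounded X)) := by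
  open DerivedHall in
  have := isDerivedHereditary.{w, w'} (A := A)
  let d₁ := FormalDecomp.ofComplex A₁ hd₁ hA₁
  let d₂ := FormalDecomp.ofComplex A₂ hd₂ hA₂
  let S := {x : ℤ →₀ IsoClass A |
    (homWithCone (Q.obj (zeroDiffComplex x)) (Q.obj A₁) ((Q.obj A₂)⟦(1 : ℤ)⟧)).Nonempty}
  have hS : S.Finite := finite_setOf_homWithCone_nonempty.{w, w'} d₁ (d₂.shift 1)
  refine ⟨(hS.image isoClassEquiv).subset fun l hl => ?_,
    (hS.biUnion fun x _ => (finite_support_structureTerm.{w, w'} d₁ d₂ x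
      (zeroDiffDecomp x)).image (Prod.mk x)).subset fun p hp => ?_, ?_⟩
  · obtain ⟨x, rfl⟩ := isoClassEquiv.surjective l
    rw [Set.mem_ofPred_eq, derivedHallNumber_toBounded hA₁ hA₂] at hl
    have h1 := left_ne_zero_of_mul hl
    rw [div_ne_zero_iff] at h1
    obtain ⟨⟨f, hf⟩⟩ := (Nat.card_ne_zero.1 (Nat.cast_ne_zero.1 h1.1)).1
    exact ⟨x, ⟨f, hf⟩, rfl⟩
  · refine Set.mem_iUnion₂.2 ⟨p.1, ?_, p.2, hp, rfl⟩
    have h : structureTerm.{w'} A₁ A₂ p.1 p.2.1 p.2.2.1 p.2.2.2 ≠ 0 := hp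
    rw [structureTerm_eq_typeOf.{w, w'} d₁ d₂ p.1 (zeroDiffDecomp p.1) p.2] at h
    have h1 := left_ne_zero_of_mul h
    rw [div_ne_zero_iff] at h1
    obtain ⟨⟨⟨f, hf⟩, -⟩⟩ := (Nat.card_ne_zero.1 (Nat.cast_ne_zero.1 h1.1)).1
    exact ⟨f, hf⟩
  · rw [basisObj_mul_basisObj, ← finsum_comp_equiv isoClassEquiv]
    refine finsum_congr fun x => ?_
    rw [derivedHallNumber_toBounded hA₁ hA₂,
      derivedHallNumber_eq_finsum.{w, w'} d₁ d₂ x (zeroDiffDecomp x)]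
    rfl
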